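/- Let $p\ge 5$ be a prime and let $G$ be a primitive permutation group on a set $\Omega$ of $3p$ points. Let $\pi$ be the permutation character of $G$, that is, the character of the complex representation of $G$ by permutation matrices. Suppose that $G$ is of Type II, meaning that $\pi = 1_G + \chi_1 + \chi_2$, where $1_G$ is the principal character and $\chi_1$, $\chi_2$ are irreducible complex characters of $G$ of degrees $p$ and $2p-1$ respectively. (In particular $G$ is not $2$-fold transitive.) Let $P$ be a Sylow $p$-subgroup of $G$ and let $N(P)$ be its normaliser in $G$. If $G$ contains no odd permutations, then $|N(P):P|$ divides $8$. If $G$ contains odd permutations, then $|N(P):P|$ divides $16$. -/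

import Mathlib

namespace PrimitiveDegree3p

/-- The permutation character `π` of a permutation group `G` on `Ω`: the character of the complex
representation of `G` by permutation matrices. -/
noncomputable def permCharacter {Ω : Type*} (G : Subgroup (Equiv.Perm Ω)) : G → ℂ :=
  (Representation.ofMulAction ℂ G Ω).character

/-- `χ` is (the character of) an irreducible complex representation of `G` of degree `d`. -/
def IsIrreducibleCharacterOfDegree {G : Type*} [Group G] (d : ℕ) (χ : G → ℂ) : Prop :=
  ∃ ρ : Representation ℂ G (Fin d → ℂ), ρ.IsIrreducible ∧ ρ.character = χ

/-- `G` (of degree `3p`) is of Type II: its permutation character is `1 + χ₁ + χ₂`, where `1` is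
the principal character and `χ₁`, `χ₂` are irreducible of degrees `p` and `2p - 1`. -/
def IsTypeII {Ω : Type*} (p : ℕ) (G : Subgroup (Equiv.Perm Ω)) : Prop :=
  ∃ χ₁ χ₂ : G → ℂ, IsIrreducibleCharacterOfDegree p χ₁ ∧
    IsIrreducibleCharacterOfDegree (2 * p - 1) χ₂ ∧
    ∀ g : G, permCharacter G g = 1 + χ₁ g + χ₂ g

end PrimitiveDegree3p

/-! The degrees $1$, $p$, $2p-1$ are distinct, so the permutation representation is multiplicity
free and every $G$-invariant matrix is $kE_0+sE_1+tE_2$ with central idempotents $E_i$ of ranks $1$,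
$p$, $2p-1$. An orbital graph therefore has three eigenvalues with these multiplicities; rationality
and integrality make them integers. The traces of $A$ and $A^2$ force, up to complement, eigenvalues
$p+t$, $-1-2t$, $t$ with $2p=6t^2+3t+1$. This strongly regular graph is a `TypeIIGraph`. If $z \in
G$ has no fixed points, then $\operatorname{tr}(AP_z)=p-(1+3t)\chi_1(z)$, so $\chi_1(z)$ is a
rational algebraic integer and $1+3t$ divides $\operatorname{tr}(AP_z)-p$.

All orbits of $P$ have length $p$, so $P$ is elementary abelian, and a count of fixed points gives
$z\in P$ without any. It cuts $\Omega$ into three blocks, each a copy of $\mathbb{Z}/p$ on which $z$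
adds $1$. The divisibility shows that each nonzero difference is an edge in exactly one diagonal
block (`sum_adj_diag`). Since no $p$ points look alike from outside (`no_module`), an element of $G$
translating each block translates all by the same amount (`translation_const`); hence $P=\langle
z\rangle$.

Elements of $N(P)$ act as $(i,x)\mapsto(\sigma i, lx+b_i)$, and $g\mapsto(\sigma,l)$ has kernel $P$.
A three-cycle $\sigma$ would make the diagonal counts equal, so $3\mid p-1$, whereas $2p\equiv1
\pmod 3$. If $\sigma=1$ and $l\ne1$, each block has a fixed point; counting neighbours modulo the
order of $l$ shows that this order divides $4$ (`orderOf_dvd_four`). The image thus has order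
dividing $2\cdot4=8$, which settles both cases. -/

namespace PrimitiveDegree3p

open Module

/-! ### Multiplicity-free decomposition by characters and Schur's lemma -/

section Multiplicity

open Representation

variable {G : Type*} [Group G] {U V W : Type*}
  [AddCommGroup U] [Module ℂ U] [AddCommGroup V] [Module ℂ V] [AddCommGroup W] [Module ℂ W]

/-- A nonzero intertwining map from an irreducible representation `ρ` can be added to an injective
intertwining map, provided `ρ` does not map to the source of the latter. -/
theorem injective_coprod_of_isIrreducible {α : Representation ℂ G U} {ρ : Representation ℂ G V}
    {σ : Representation ℂ G W} [ρ.IsIrreducible] [Subsingleton (IntertwiningMap ρ α)]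
    (f : IntertwiningMap α σ) (hf : Function.Injective f) (f' : IntertwiningMap ρ σ)
    (hf' : f' ≠ 0) :
    Function.Injective (LinearMap.coprod f.toLinearMap f'.toLinearMap) := by
  -- The preimage under `f'` of the range of `f`. By irreducibility it is `⊥`, which gives
  -- injectivity, or `⊤`, in which case `f'` factors through `f`.
  let S : Subrepresentation ρ :=
    ⟨(LinearMap.range f.toLinearMap).comap f'.toLinearMap, by
      rintro g v ⟨u, hu⟩
      refine ⟨α g u, ?_⟩
      have h1 := f.isIntertwining _ _ g u
      have h2 := f'.isIntertwining _ _ g v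
      simp only [IntertwiningMap.toLinearMap_apply] at hu ⊢
      rw [h1, h2, hu]⟩
  have hS : ∀ v, v ∈ S ↔ ∃ u, f u = f' v := fun v => Iff.rfl
  rcases IsSimpleOrder.eq_bot_or_eq_top S with h | h
  · rw [injective_iff_map_eq_zero]
    rintro ⟨u, v⟩ huv
    have huv' : f u + f' v = 0 := by simpa using huv
    have hv : v ∈ S := (hS v).2 ⟨-u, by rw [map_neg]; exact neg_eq_of_add_eq_zero_right huv'⟩
    rw [h] at hv
    have hv0 : v = 0 := hv
    subst hv0
    have : f u = f 0 := by simpa using huv'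
    simp [hf this]
  · have hall : ∀ v, ∃ u, f u = f' v := fun v => (hS v).1 (by rw [h]; trivial)
    choose r hr using hall
    let L : IntertwiningMap ρ α :=
      ⟨{ toFun := r
         map_add' := fun a b => hf (by rw [map_add, hr, hr, hr, map_add])
         map_smul' := fun a b => hf (by simp only [map_smul, hr, RingHom.id_apply]) },
        fun g => by
          ext v
          apply hf
          have h1 := f.isIntertwining _ _ g (r v)
          have h2 := f'.isIntertwining _ _ g v
          simp only [LinearMap.comp_apply, LinearMap.coe_mk, AddHom.coe_mk]
          rw [hr, h1, h2, hr]⟩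
    exfalso
    apply hf'
    have hL : L = 0 := Subsingleton.elim _ _
    ext v
    change f' v = 0
    rw [← hr v]
    have : r v = 0 := congrArg (fun M : IntertwiningMap ρ α => M v) hL
    rw [this, map_zero]

theorem isEmpty_equiv_of_finrank_ne {ρ : Representation ℂ G V} {σ : Representation ℂ G W}
    (h : finrank ℂ V ≠ finrank ℂ W) : IsEmpty (Equiv ρ σ) :=
  ⟨fun e => h e.toLinearEquiv.finrank_eq⟩

theorem subsingleton_intertwiningMap_prod {α : Representation ℂ G U} {β : Representation ℂ G V}
    {ρ : Representation ℂ G W} [Subsingleton (IntertwiningMap ρ α)]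
    [Subsingleton (IntertwiningMap ρ β)] : Subsingleton (IntertwiningMap ρ (α.prod β)) := by
  refine ⟨fun f g => ?_⟩
  have h1 : (IntertwiningMap.fst ℂ α β).comp f = (IntertwiningMap.fst ℂ α β).comp g :=
    Subsingleton.elim _ _
  have h2 : (IntertwiningMap.snd ℂ α β).comp f = (IntertwiningMap.snd ℂ α β).comp g :=
    Subsingleton.elim _ _
  ext v
  · exact congrArg (fun M : IntertwiningMap ρ α => M v) h1
  · exact congrArg (fun M : IntertwiningMap ρ β => M v) h2

theorem isIrreducible_trivial : (Representation.trivial ℂ G ℂ).IsIrreducible := by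
  have : Nontrivial (Subrepresentation (Representation.trivial ℂ G ℂ)) := by
    refine ⟨⊥, ⊤, fun h => ?_⟩
    have : (1 : ℂ) ∈ (⊤ : Subrepresentation (Representation.trivial ℂ G ℂ)) := trivial
    rw [← h] at this
    exact one_ne_zero this
  refine ⟨fun S => ?_⟩
  rcases eq_bot_or_eq_top S.toSubmodule with h | h
  · left; exact Subrepresentation.toSubmodule_injective h
  · right; exact Subrepresentation.toSubmodule_injective h

/-- Multiplicities in a representation whose character is a sum of three characters. -/
theorem finrank_intertwiningMap_eq_one [Finite G] {X Y : Type*} [AddCommGroup X] [Module ℂ X]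
    [AddCommGroup Y] [Module ℂ Y] [FiniteDimensional ℂ U] [FiniteDimensional ℂ V]
    [FiniteDimensional ℂ W] [FiniteDimensional ℂ X] [FiniteDimensional ℂ Y]
    {α : Representation ℂ G U} {β : Representation ℂ G V} {γ : Representation ℂ G W}
    {σ : Representation ℂ G X} (ρ : Representation ℂ G Y)
    (hchar : ∀ g, σ.character g = α.character g + β.character g + γ.character g)
    (h : finrank ℂ (IntertwiningMap ρ α) + finrank ℂ (IntertwiningMap ρ β)
      + finrank ℂ (IntertwiningMap ρ γ) = 1) :
    finrank ℂ (IntertwiningMap ρ σ) = 1 := by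
  have := Fintype.ofFinite G
  have hG : (Nat.card G : ℂ) ≠ 0 := by exact_mod_cast Nat.card_pos.ne'
  let _ : Invertible (Nat.card G : ℂ) := invertibleOfNonzero hG
  have : (finrank ℂ (IntertwiningMap ρ σ) : ℂ) = 1 := by
    rw [← Nat.cast_one, ← h]
    push_cast
    simp only [← card_inv_mul_sum_char_mul_char_eq_finrank, hchar, add_mul,
      Finset.sum_add_distrib, mul_add]
  exact_mod_cast this

/-- `T ∘ f` is again an intertwining map, hence a multiple of the generator `f`. -/
theorem exists_apply_eq_of_commute {X Y : Type*} [AddCommGroup X] [Module ℂ X] [AddCommGroup Y]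
    [Module ℂ Y] {σ : Representation ℂ G X} (T : X →ₗ[ℂ] X) (hT : ∀ g, T ∘ₗ σ g = σ g ∘ₗ T)
    (ρ : Representation ℂ G Y) (f : IntertwiningMap ρ σ)
    (hf : ∀ f' : IntertwiningMap ρ σ, ∃ r : ℂ, r • f = f') : ∃ r : ℂ, ∀ y, T (f y) = f (r • y) := by
  obtain ⟨r, hr⟩ := hf ⟨T ∘ₗ f.toLinearMap, fun g => by
    ext y
    have h1 := f.isIntertwining _ _ g y
    have h2 := LinearMap.congr_fun (hT g) (f y)
    simp only [LinearMap.comp_apply, IntertwiningMap.toLinearMap_apply] at h2 ⊢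
    rw [h1, h2]⟩
  refine ⟨r, fun y => ?_⟩
  rw [map_smul]
  exact (congrArg (fun M : IntertwiningMap ρ σ => M y) hr).symm

/-- A representation whose character is a sum of three irreducible characters of distinct degrees
is the direct sum of the three representations, and every commuting endomorphism acts on each of
the summands as a scalar. -/
theorem exists_equiv_prod_of_character_eq [Finite G] {X : Type*} [AddCommGroup X] [Module ℂ X]
    [FiniteDimensional ℂ U] [FiniteDimensional ℂ V] [FiniteDimensional ℂ W]
    [FiniteDimensional ℂ X]
    (α : Representation ℂ G U) (β : Representation ℂ G V) (γ : Representation ℂ G W)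
    (σ : Representation ℂ G X) [α.IsIrreducible] [β.IsIrreducible] [γ.IsIrreducible]
    (hαβ : finrank ℂ U ≠ finrank ℂ V) (hαγ : finrank ℂ U ≠ finrank ℂ W)
    (hβγ : finrank ℂ V ≠ finrank ℂ W)
    (hdim : finrank ℂ U + finrank ℂ V + finrank ℂ W = finrank ℂ X)
    (hchar : ∀ g, σ.character g = α.character g + β.character g + γ.character g) :
    ∃ F : ((U × V) × W) ≃ₗ[ℂ] X,
      (∀ g u v w, σ g (F ((u, v), w)) = F ((α g u, β g v), γ g w)) ∧
      ∀ T : X →ₗ[ℂ] X, (∀ g, T ∘ₗ σ g = σ g ∘ₗ T) →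
        ∃ k s t : ℂ, ∀ u v w, T (F ((u, v), w)) = F ((k • u, s • v), t • w) := by
  classical
  have := Fintype.ofFinite G
  have hG : (Nat.card G : ℂ) ≠ 0 := by exact_mod_cast Nat.card_pos.ne'
  let _ : Invertible (Nat.card G : ℂ) := invertibleOfNonzero hG
  have e1 := isEmpty_equiv_of_finrank_ne (ρ := α) (σ := β) hαβ
  have e2 := isEmpty_equiv_of_finrank_ne (ρ := β) (σ := α) hαβ.symm
  have e3 := isEmpty_equiv_of_finrank_ne (ρ := α) (σ := γ) hαγ
  have e4 := isEmpty_equiv_of_finrank_ne (ρ := γ) (σ := α) hαγ.symm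
  have e5 := isEmpty_equiv_of_finrank_ne (ρ := β) (σ := γ) hβγ
  have e6 := isEmpty_equiv_of_finrank_ne (ρ := γ) (σ := β) hβγ.symm
  have hα : finrank ℂ (IntertwiningMap α σ) = 1 := finrank_intertwiningMap_eq_one α hchar (by
    rw [IsIrreducible.finrank_intertwiningMap_self, finrank_zero_of_subsingleton,
      finrank_zero_of_subsingleton])
  have hβ : finrank ℂ (IntertwiningMap β σ) = 1 := finrank_intertwiningMap_eq_one β hchar (by
    rw [IsIrreducible.finrank_intertwiningMap_self, finrank_zero_of_subsingleton,
      finrank_zero_of_subsingleton])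
  have hγ : finrank ℂ (IntertwiningMap γ σ) = 1 := finrank_intertwiningMap_eq_one γ hchar (by
    rw [IsIrreducible.finrank_intertwiningMap_self, finrank_zero_of_subsingleton,
      finrank_zero_of_subsingleton])
  obtain ⟨a, ha0, ha⟩ := finrank_eq_one_iff'.1 hα
  obtain ⟨b, hb0, hb⟩ := finrank_eq_one_iff'.1 hβ
  obtain ⟨c, hc0, hc⟩ := finrank_eq_one_iff'.1 hγ
  have hainj := (IsIrreducible.injective_or_eq_zero a).resolve_right ha0
  have hab := injective_coprod_of_isIrreducible a hainj b hb0
  let ab : IntertwiningMap (α.prod β) σ :=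
    ⟨LinearMap.coprod a.toLinearMap b.toLinearMap, fun g => by
      ext v
      · simpa using a.isIntertwining _ _ g v
      · simpa using b.isIntertwining _ _ g v⟩
  have : Subsingleton (IntertwiningMap γ (α.prod β)) := subsingleton_intertwiningMap_prod
  have habc := injective_coprod_of_isIrreducible ab hab c hc0
  -- Injectivity suffices because the dimensions agree.
  let F : ((U × V) × W) ≃ₗ[ℂ] X := LinearEquiv.ofInjectiveOfFinrankEq _ habc (by
    rw [finrank_prod, finrank_prod, hdim])
  have hF : ∀ u v w, F ((u, v), w) = a u + b v + c w := fun u v w => rfl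
  refine ⟨F, fun g u v w => ?_, fun T hT => ?_⟩
  · simp only [hF, map_add]
    rw [a.isIntertwining _ _ g u, b.isIntertwining _ _ g v, c.isIntertwining _ _ g w]
  · obtain ⟨k, hk⟩ := exists_apply_eq_of_commute T hT α a ha
    obtain ⟨s, hs⟩ := exists_apply_eq_of_commute T hT β b hb
    obtain ⟨t, ht⟩ := exists_apply_eq_of_commute T hT γ c hc
    exact ⟨k, s, t, fun u v w => by simp only [hF, map_add, hk, hs, ht]⟩

end Multiplicity

/-! ### The algebra of invariant matrices and its central idempotents -/

section Centralizer

variable {Ω : Type*} [Fintype Ω]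

/-- A matrix indexed by `Ω` is invariant under the permutation group `G`. -/
def IsInvariantMatrix (G : Subgroup (Equiv.Perm Ω)) (A : Matrix Ω Ω ℂ) : Prop :=
  ∀ g ∈ G, ∀ x y, A (g x) (g y) = A x y

/-- The basis of the permutation module indexed by the points. -/
noncomputable def permBasis (Ω : Type*) : Basis Ω ℂ (MonoidAlgebra ℂ Ω) :=
  Basis.ofRepr (MonoidAlgebra.coeffLinearEquiv ℂ)

omit [Fintype Ω] in
theorem permBasis_apply (x : Ω) : permBasis Ω x = MonoidAlgebra.single x 1 := rfl

omit [Fintype Ω] in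
theorem ofMulAction_permBasis (G : Subgroup (Equiv.Perm Ω)) (g : G) (x : Ω) :
    Representation.ofMulAction ℂ G Ω g (permBasis Ω x) = permBasis Ω ((g : Equiv.Perm Ω) x) := by
  rw [permBasis_apply, permBasis_apply, Representation.ofMulAction_single]
  rfl

variable [DecidableEq Ω]

theorem toMatrix_mul_ofMulAction (G : Subgroup (Equiv.Perm Ω)) (g : G)
    (T : MonoidAlgebra ℂ Ω →ₗ[ℂ] MonoidAlgebra ℂ Ω) (x y : Ω) :
    LinearMap.toMatrix (permBasis Ω) (permBasis Ω) (T ∘ₗ Representation.ofMulAction ℂ G Ω g) x y =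
      LinearMap.toMatrix (permBasis Ω) (permBasis Ω) T x ((g : Equiv.Perm Ω) y) := by
  rw [LinearMap.toMatrix_apply, LinearMap.toMatrix_apply, LinearMap.comp_apply,
    ofMulAction_permBasis]

theorem trace_comp_ofMulAction (G : Subgroup (Equiv.Perm Ω)) (g : G)
    (T : MonoidAlgebra ℂ Ω →ₗ[ℂ] MonoidAlgebra ℂ Ω) :
    LinearMap.trace ℂ _ (T ∘ₗ Representation.ofMulAction ℂ G Ω g) =
      ∑ x, LinearMap.toMatrix (permBasis Ω) (permBasis Ω) T x ((g : Equiv.Perm Ω) x) := by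
  rw [LinearMap.trace_eq_matrix_trace ℂ (permBasis Ω), Matrix.trace]
  exact Finset.sum_congr rfl fun x _ => toMatrix_mul_ofMulAction G g T x x

theorem ofMulAction_mul_toMatrix (G : Subgroup (Equiv.Perm Ω)) (g : G)
    (T : MonoidAlgebra ℂ Ω →ₗ[ℂ] MonoidAlgebra ℂ Ω) (x y : Ω) :
    LinearMap.toMatrix (permBasis Ω) (permBasis Ω) (Representation.ofMulAction ℂ G Ω g ∘ₗ T)
      ((g : Equiv.Perm Ω) x) y =
      LinearMap.toMatrix (permBasis Ω) (permBasis Ω) T x y := by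
  rw [LinearMap.toMatrix_comp _ (permBasis Ω), Matrix.mul_apply, Finset.sum_eq_single x]
  · rw [LinearMap.toMatrix_apply, ofMulAction_permBasis]
    simp
  · intro z _ hz
    rw [LinearMap.toMatrix_apply, ofMulAction_permBasis]
    have : (g : Equiv.Perm Ω) z ≠ (g : Equiv.Perm Ω) x := fun h => hz (Equiv.injective _ h)
    simp [this]
  · simp

theorem commute_iff_isInvariantMatrix (G : Subgroup (Equiv.Perm Ω))
    (T : MonoidAlgebra ℂ Ω →ₗ[ℂ] MonoidAlgebra ℂ Ω) :
    (∀ g, T ∘ₗ Representation.ofMulAction ℂ G Ω g = Representation.ofMulAction ℂ G Ω g ∘ₗ T) ↔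
      IsInvariantMatrix G (LinearMap.toMatrix (permBasis Ω) (permBasis Ω) T) := by
  constructor
  · intro h g hg x y
    have := ofMulAction_mul_toMatrix G ⟨g, hg⟩ T x y
    rw [← h, toMatrix_mul_ofMulAction] at this
    exact this
  · intro h g
    apply (LinearMap.toMatrix (permBasis Ω) (permBasis Ω)).injective
    ext x y
    obtain ⟨x, rfl⟩ := (g : Equiv.Perm Ω).surjective x
    rw [ofMulAction_mul_toMatrix, toMatrix_mul_ofMulAction]
    exact h g g.2 x y

/-- A value of a character of a finite group is an algebraic integer. -/
theorem isIntegral_character {G V : Type*} [Group G] [Finite G] [AddCommGroup V] [Module ℂ V]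
    [FiniteDimensional ℂ V] (ρ : Representation ℂ G V) (g : G) :
    IsIntegral ℤ (ρ.character g) := by
  rw [Representation.character,
    Module.End.trace_eq_sum_roots_charpoly_of_splits (IsAlgClosed.splits _)]
  apply IsIntegral.multiset_sum
  intro μ hμ
  have hμ' : Module.End.HasEigenvalue (ρ g) μ := by
    rw [Module.End.hasEigenvalue_iff_isRoot_charpoly]
    exact (Polynomial.mem_roots'.1 hμ).2
  obtain ⟨v, hv⟩ := hμ'.exists_hasEigenvector
  have h1 := hv.pow_apply (orderOf g)
  rw [← map_pow, pow_orderOf_eq_one, map_one] at h1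
  have h2 : (μ ^ orderOf g - 1) • v = 0 := by
    rw [sub_smul, ← h1]; simp
  have h3 : μ ^ orderOf g = 1 := by
    rcases smul_eq_zero.1 h2 with h | h
    · exact sub_eq_zero.1 h
    · exact absurd h hv.2
  exact IsIntegral.of_pow (orderOf_pos g) (h3 ▸ isIntegral_one)

/-- The central idempotents of the algebra of invariant matrices of a group of Type II. -/
structure CentralIdempotents (p : ℕ) (G : Subgroup (Equiv.Perm Ω)) where
  E₀ : Matrix Ω Ω ℂ
  E₁ : Matrix Ω Ω ℂ
  E₂ : Matrix Ω Ω ℂ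
  χ₁ : G → ℂ
  χ₂ : G → ℂ
  integral : ∀ g, IsIntegral ℤ (χ₁ g)
  inv₁ : IsInvariantMatrix G E₁
  sum_eq_one : E₀ + E₁ + E₂ = 1
  mul₀₀ : E₀ * E₀ = E₀
  mul₁₁ : E₁ * E₁ = E₁
  mul₂₂ : E₂ * E₂ = E₂
  mul₀₁ : E₀ * E₁ = 0
  mul₁₀ : E₁ * E₀ = 0
  mul₀₂ : E₀ * E₂ = 0
  mul₂₀ : E₂ * E₀ = 0
  mul₁₂ : E₁ * E₂ = 0
  mul₂₁ : E₂ * E₁ = 0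
  trace₀ : ∀ g : G, ∑ x, E₀ x ((g : Equiv.Perm Ω) x) = 1
  trace₁ : ∀ g : G, ∑ x, E₁ x ((g : Equiv.Perm Ω) x) = χ₁ g
  trace₂ : ∀ g : G, ∑ x, E₂ x ((g : Equiv.Perm Ω) x) = χ₂ g
  one₁ : χ₁ 1 = p
  one₂ : χ₂ 1 = 2 * p - 1
  exists_eq : ∀ A, IsInvariantMatrix G A → ∃ k s t : ℂ, A = k • E₀ + s • E₁ + t • E₂

/-- The idempotents are the projections onto the three summands of the permutation module, written
in the basis of points. An invariant matrix commutes with $G$, so it is scalar on each summand. -/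
theorem IsTypeII.nonempty_centralIdempotents {p : ℕ} (hp5 : 5 ≤ p)
    (hΩ : Fintype.card Ω = 3 * p) {G : Subgroup (Equiv.Perm Ω)} (h : IsTypeII p G) :
    Nonempty (CentralIdempotents p G) := by
  obtain ⟨χ₁, χ₂, ⟨ρ₁, hρ₁, rfl⟩, ⟨ρ₂, hρ₂, rfl⟩, hsum⟩ := h
  have h0 := isIrreducible_trivial (G := G)
  obtain ⟨F, hF, hT⟩ := exists_equiv_prod_of_character_eq (Representation.trivial ℂ G ℂ) ρ₁ ρ₂
    (Representation.ofMulAction ℂ G Ω) (by simp; omega) (by simp; omega) (by simp; omega)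
    (by rw [finrank_eq_card_basis (permBasis Ω), hΩ]; simp; omega)
    (fun g => by
      rw [show Representation.character (Representation.ofMulAction ℂ G Ω) g = _ from hsum g]
      congr 2
      simp [Representation.character])
  let B := LinearMap.toMatrix (permBasis Ω) (permBasis Ω)
  let C (T : ((ℂ × (Fin p → ℂ)) × (Fin (2 * p - 1) → ℂ)) →ₗ[ℂ]
      ((ℂ × (Fin p → ℂ)) × (Fin (2 * p - 1) → ℂ))) := F.toLinearMap ∘ₗ T ∘ₗ F.symm.toLinearMap
  have hC : ∀ S T, B (C S) * B (C T) = B (C (S ∘ₗ T)) := fun S T => by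
    rw [← LinearMap.toMatrix_comp]
    congr 1
    ext v
    simp [C]
  -- The operator acting as `a`, `b`, `c` on the three summands; products, sums and traces of the
  -- idempotents are all read off from this family.
  let i (a b c : ℂ) : ((ℂ × (Fin p → ℂ)) × (Fin (2 * p - 1) → ℂ)) →ₗ[ℂ]
      ((ℂ × (Fin p → ℂ)) × (Fin (2 * p - 1) → ℂ)) :=
    ((a • LinearMap.id).prodMap (b • LinearMap.id)).prodMap (c • LinearMap.id)
  have hi : ∀ a b c a' b' c', i a b c ∘ₗ i a' b' c' = i (a * a') (b * b') (c * c') := by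
    intros
    apply LinearMap.ext
    rintro ⟨⟨u, v⟩, w⟩
    simp only [i, LinearMap.comp_apply, LinearMap.prodMap_apply, LinearMap.smul_apply,
      LinearMap.id_apply, smul_smul]
  have hmul : ∀ a b c a' b' c', B (C (i a b c)) * B (C (i a' b' c')) =
      B (C (i (a * a') (b * b') (c * c'))) := fun a b c a' b' c' => by rw [hC, hi]
  have hlin : ∀ a b c, B (C (i a b c)) = a • B (C (i 1 0 0)) + b • B (C (i 0 1 0))
      + c • B (C (i 0 0 1)) := by
    intro a b c
    simp only [← map_smul, ← map_add]
    congr 1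
    apply LinearMap.ext
    intro x
    obtain ⟨⟨⟨u, v⟩, w⟩, rfl⟩ := F.surjective x
    simp only [C, i, LinearMap.comp_apply, LinearEquiv.coe_coe, LinearEquiv.symm_apply_apply,
      LinearMap.add_apply, LinearMap.smul_apply, ← map_smul, ← map_add]
    simp
  have hzero : B (C (i 0 0 0)) = 0 := by simpa using hlin 0 0 0
  have hone : B (C (i 1 1 1)) = 1 := by
    rw [← LinearMap.toMatrix_id (permBasis Ω)]
    congr 1
    apply LinearMap.ext
    intro x
    obtain ⟨⟨⟨u, v⟩, w⟩, rfl⟩ := F.surjective x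
    simp [C, i]
  have htr : ∀ a b c (g : G), ∑ x, B (C (i a b c)) x ((g : Equiv.Perm Ω) x) =
      a + b * ρ₁.character g + c * ρ₂.character g := by
    intro a b c g
    rw [← trace_comp_ofMulAction]
    have : C (i a b c) ∘ₗ Representation.ofMulAction ℂ G Ω g =
        F.conj (((a • LinearMap.id).prodMap (b • ρ₁ g)).prodMap (c • ρ₂ g)) := by
      apply LinearMap.ext
      intro x
      obtain ⟨⟨⟨u, v⟩, w⟩, rfl⟩ := F.surjective x
      rw [LinearMap.comp_apply, hF]
      simp [C, i, LinearEquiv.conj_apply]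
    rw [this, LinearMap.trace_conj', LinearMap.trace_prodMap', LinearMap.trace_prodMap']
    simp [Representation.character]
  have hcomm : ∀ a b c, IsInvariantMatrix G (B (C (i a b c))) := by
    intro a b c
    rw [← commute_iff_isInvariantMatrix]
    intro g
    apply LinearMap.ext
    intro x
    obtain ⟨⟨⟨u, v⟩, w⟩, rfl⟩ := F.surjective x
    simp only [LinearMap.comp_apply, hF]
    simp [C, i, hF]
  refine ⟨{ E₀ := B (C (i 1 0 0)), E₁ := B (C (i 0 1 0)), E₂ := B (C (i 0 0 1)),
            χ₁ := ρ₁.character, χ₂ := ρ₂.character, integral := isIntegral_character ρ₁,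
            inv₁ := hcomm _ _ _, sum_eq_one := ?_, mul₀₀ := ?_, mul₁₁ := ?_, mul₂₂ := ?_,
            mul₀₁ := ?_, mul₁₀ := ?_, mul₀₂ := ?_, mul₂₀ := ?_, mul₁₂ := ?_, mul₂₁ := ?_,
            trace₀ := ?_, trace₁ := ?_, trace₂ := ?_, one₁ := ?_, one₂ := ?_, exists_eq := ?_ }⟩
  · rw [← hone, hlin 1 1 1]; simp
  any_goals (rw [hmul]; simp [hzero])
  any_goals (intro g; rw [htr]; simp)
  · simp
  · rw [Representation.char_one]
    simp only [finrank_fintype_fun_eq_card, Fintype.card_fin]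
    rw [Nat.cast_sub (by omega)]; push_cast; ring
  · intro A hA
    have hA' := (commute_iff_isInvariantMatrix G
      (Matrix.toLin (permBasis Ω) (permBasis Ω) A)).2 (by rwa [LinearMap.toMatrix_toLin])
    obtain ⟨k, s, t, h⟩ := hT _ hA'
    refine ⟨k, s, t, ?_⟩
    rw [← hlin, ← LinearMap.toMatrix_toLin (permBasis Ω) (permBasis Ω) A]
    change B _ = B _
    congr 1
    apply LinearMap.ext
    intro x
    obtain ⟨⟨⟨u, v⟩, w⟩, rfl⟩ := F.surjective x
    rw [h]
    simp [C, i]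

end Centralizer

/-! ### Calculus in the span of the idempotents; rank three and symmetry -/

section Graph

variable {Ω : Type*} [Fintype Ω] [DecidableEq Ω] {p : ℕ} {G : Subgroup (Equiv.Perm Ω)}

namespace CentralIdempotents

variable (D : CentralIdempotents p G)

/-- The combination of the central idempotents with given coefficients. -/
def comb (k s t : ℂ) : Matrix Ω Ω ℂ := k • D.E₀ + s • D.E₁ + t • D.E₂

theorem comb_mul (k s t k' s' t' : ℂ) :
    D.comb k s t * D.comb k' s' t' = D.comb (k * k') (s * s') (t * t') := by
  simp only [comb, add_mul, mul_add, Matrix.smul_mul, Matrix.mul_smul, D.mul₀₀, D.mul₁₁, D.mul₂₂,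
    D.mul₀₁, D.mul₁₀, D.mul₀₂, D.mul₂₀, D.mul₁₂, D.mul₂₁, smul_zero, smul_smul, add_zero, zero_add,
    mul_comm]

theorem comb_add (k s t k' s' t' : ℂ) :
    D.comb k s t + D.comb k' s' t' = D.comb (k + k') (s + s') (t + t') := by
  simp only [comb, add_smul]; abel

theorem smul_comb (r k s t : ℂ) : r • D.comb k s t = D.comb (r * k) (r * s) (r * t) := by
  simp only [comb, smul_add, smul_smul]

theorem comb_one : D.comb 1 1 1 = 1 := by simp [comb, D.sum_eq_one]

theorem comb_sub (k s t k' s' t' : ℂ) :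
    D.comb k s t - D.comb k' s' t' = D.comb (k - k') (s - s') (t - t') := by
  simp only [comb, sub_smul]; abel

theorem comb_trace (k s t : ℂ) (g : G) :
    ∑ x, D.comb k s t x ((g : Equiv.Perm Ω) x) = k + s * D.χ₁ g + t * D.χ₂ g := by
  simp only [comb, Matrix.add_apply, Matrix.smul_apply, smul_eq_mul, Finset.sum_add_distrib,
    ← Finset.mul_sum, D.trace₀, D.trace₁, D.trace₂, mul_one]

theorem trace_comb (k s t : ℂ) : (D.comb k s t).trace = k + s * p + t * (2 * p - 1) := by
  have := D.comb_trace k s t 1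
  rwa [D.one₁, D.one₂] at this

theorem comb_eq_zero (hp : 5 ≤ p) {k s t : ℂ} (h : D.comb k s t = 0) : k = 0 ∧ s = 0 ∧ t = 0 := by
  -- Multiplying by `comb a b c` and taking traces isolates each coefficient.
  have key : ∀ a b c : ℂ, k * a + s * b * p + t * c * (2 * p - 1) = 0 := fun a b c => by
    rw [← D.trace_comb, ← D.comb_mul, h, zero_mul, Matrix.trace_zero]
  have h1 : (p : ℂ) ≠ 0 := by exact_mod_cast (by omega : p ≠ 0)
  have h2 : (2 * p - 1 : ℂ) ≠ 0 := by
    rw [sub_ne_zero]; exact_mod_cast (by omega : 2 * p ≠ 1)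
  refine ⟨by simpa using key 1 0 0, ?_, ?_⟩
  · simpa [h1] using key 0 1 0
  · simpa [h2] using key 0 0 1

theorem comb_inj (hp : 5 ≤ p) {k s t k' s' t' : ℂ} (h : D.comb k s t = D.comb k' s' t') :
    k = k' ∧ s = s' ∧ t = t' := by
  have := D.comb_eq_zero hp (by rw [← D.comb_sub, h, sub_self] :
    D.comb (k - k') (s - s') (t - t') = 0)
  simpa only [sub_eq_zero] using this

/-- The all-one matrix. -/
theorem ones_eq (hp : 5 ≤ p) (hΩ : Fintype.card Ω = 3 * p) :
    (Matrix.of fun _ _ => 1 : Matrix Ω Ω ℂ) = D.comb (3 * p) 0 0 := by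
  obtain ⟨k, s, t, h⟩ := D.exists_eq (Matrix.of fun _ _ => 1) (fun _ _ _ _ => rfl)
  change _ = D.comb k s t at h
  have hsq : (Matrix.of fun _ _ => 1 : Matrix Ω Ω ℂ) * (Matrix.of fun _ _ => 1) =
      (3 * p : ℂ) • (Matrix.of fun _ _ => 1 : Matrix Ω Ω ℂ) := by
    ext x y
    simp [Matrix.mul_apply, hΩ]
  have htr : (Matrix.of fun _ _ => 1 : Matrix Ω Ω ℂ).trace = 3 * p := by
    simp [Matrix.trace, hΩ]
  rw [h, D.comb_mul, D.smul_comb] at hsq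
  obtain ⟨hk, hs, ht⟩ := D.comb_inj hp hsq
  rw [h, D.trace_comb] at htr
  have h1 : (p : ℂ) ≠ 0 := by exact_mod_cast (by omega : p ≠ 0)
  rw [h]
  have cases : ∀ x : ℂ, x * x = 3 * p * x → x = 0 ∨ x = 3 * p := fun x hx => by
    rcases eq_or_ne x 0 with h0 | h0
    · exact Or.inl h0
    · exact Or.inr (mul_right_cancel₀ h0 hx)
  -- As $J^2=3pJ$, each coefficient is $0$ or $3p$. Dividing the trace by $3p$ leaves
  -- $a+bp+c(2p-1)=1$ with $a,b,c\in\{0,1\}$.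
  have clear : ∀ a b c : ℕ, ((3 * p * a + 3 * p * b * p + 3 * p * c * (2 * p - 1) : ℂ) = 3 * p) →
      (a = 1 ∧ b = 0 ∧ c = 0) ∨ a ≥ 2 ∨ b ≥ 2 ∨ c ≥ 2 := fun a b c hh => by
    have h4 : (a : ℂ) + b * p + c * (2 * p) = 1 + c := by
      have : (3 * p : ℂ) * (a + b * p + c * (2 * p)) = 3 * p * (1 + c) := by linear_combination hh
      exact mul_left_cancel₀ (by simp [h1]) this
    have h5 : a + b * p + c * (2 * p) = 1 + c := by exact_mod_cast h4
    by_contra! hcon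
    obtain ⟨h6, h7, h8, h9⟩ := hcon
    interval_cases b <;> interval_cases c <;> interval_cases a <;> omega
  have fin : ∃ a b c : ℕ, a < 2 ∧ b < 2 ∧ c < 2 ∧ k = 3 * p * a ∧ s = 3 * p * b ∧
      t = 3 * p * c := by
    have one : ∀ x : ℂ, x * x = 3 * p * x → ∃ a : ℕ, a < 2 ∧ x = 3 * p * a := fun x hx => by
      rcases cases x hx with h0 | h0
      · exact ⟨0, by omega, by simp [h0]⟩
      · exact ⟨1, by omega, by simp [h0]⟩
    obtain ⟨a, ha, ha'⟩ := one k hk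
    obtain ⟨b, hb, hb'⟩ := one s hs
    obtain ⟨c, hc, hc'⟩ := one t ht
    exact ⟨a, b, c, ha, hb, hc, ha', hb', hc'⟩
  obtain ⟨a, b, c, ha, hb, hc, rfl, rfl, rfl⟩ := fin
  rcases clear a b c htr with ⟨rfl, rfl, rfl⟩ | h | h | h
  · simp
  all_goals omega

/-- The coefficient of an invariant matrix with constant row sum at the first idempotent. -/
theorem eq_of_row_sum (hp : 5 ≤ p) (hΩ : Fintype.card Ω = 3 * p) {A : Matrix Ω Ω ℂ} {k s t r : ℂ}
    (hA : A = D.comb k s t) (hr : ∀ x, ∑ y, A x y = r) : k = r := by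
  have h : A * (Matrix.of fun _ _ => 1) = r • (Matrix.of fun _ _ => 1 : Matrix Ω Ω ℂ) := by
    ext x y
    simp [Matrix.mul_apply, hr]
  rw [D.ones_eq hp hΩ, hA, D.comb_mul, D.smul_comb] at h
  have h1 : (3 * p : ℂ) ≠ 0 := by exact_mod_cast (by omega : 3 * p ≠ 0)
  exact mul_right_cancel₀ h1 (D.comb_inj hp h).1

/-- An invariant antisymmetric matrix is zero. -/
theorem eq_zero_of_transpose_eq_neg (D : CentralIdempotents p G) (hp : 5 ≤ p)
    (hΩ : Fintype.card Ω = 3 * p) {A : Matrix Ω Ω ℂ} (hA : IsInvariantMatrix G A)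
    (hT : A.transpose = -A) : A = 0 := by
  obtain ⟨k, s, t, h⟩ := D.exists_eq A hA
  change A = D.comb k s t at h
  have tr0 : ∀ B : Matrix Ω Ω ℂ, B.transpose = -B → B.trace = 0 := fun B hB => by
    have h1 : B.trace = -B.trace := by
      conv_lhs => rw [← Matrix.trace_transpose, hB, Matrix.trace_neg]
    exact self_eq_neg.1 h1
  have h1 := tr0 A hT
  have h3 := tr0 (A * A * A) (by
    rw [Matrix.transpose_mul, Matrix.transpose_mul, hT]; simp [mul_assoc])
  have hJ := tr0 ((Matrix.of fun _ _ => 1 : Matrix Ω Ω ℂ) * A * (Matrix.of fun _ _ => 1)) (by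
    rw [Matrix.transpose_mul, Matrix.transpose_mul, hT]
    have : (Matrix.of fun _ _ => 1 : Matrix Ω Ω ℂ).transpose = Matrix.of fun _ _ => 1 := rfl
    rw [this]; simp [mul_assoc])
  rw [D.ones_eq hp hΩ, h, D.comb_mul, D.comb_mul, D.trace_comb] at hJ
  rw [h, D.comb_mul, D.comb_mul, D.trace_comb] at h3
  rw [h, D.trace_comb] at h1
  have hp0 : (p : ℂ) ≠ 0 := by exact_mod_cast (by omega : p ≠ 0)
  have hp1 : (p : ℂ) - 1 ≠ 0 := by rw [sub_ne_zero]; exact_mod_cast (by omega : p ≠ 1)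
  have hp2 : (2 * p : ℂ) - 1 ≠ 0 := by rw [sub_ne_zero]; exact_mod_cast (by omega : 2 * p ≠ 1)
  have hp3 : (3 * p : ℂ) - 1 ≠ 0 := by rw [sub_ne_zero]; exact_mod_cast (by omega : 3 * p ≠ 1)
  have hk : k = 0 := by simpa [hp0] using hJ
  subst hk
  -- With $x=sp$ and $y=t(2p-1)$, `h1` reads $x+y=0$ and hence $x^3+y^3=0$; subtracting $p^2$ times
  -- `h3` leaves $t^3(2p-1)((2p-1)^2-p^2)=0$.
  have ht : (2 * p - 1) * ((p - 1) * ((3 * p - 1) * (t ^ 3))) = (0 : ℂ) := by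
    linear_combination (-p ^ 2 : ℂ) * h3 + ((s * p) ^ 2 - (s * p) * (t * (2 * p - 1))
      + (t * (2 * p - 1)) ^ 2) * h1
  have ht0 : t = 0 := by simpa [hp1, hp2, hp3] using ht
  subst ht0
  have hs0 : s = 0 := by simpa [hp0] using h1
  rw [h, hs0]
  simp [comb]

/-- The group is not doubly transitive. -/
theorem exists_not_related (D : CentralIdempotents p G) (hp : 5 ≤ p)
    (hΩ : Fintype.card Ω = 3 * p) :
    ∃ x y x' y' : Ω, x ≠ y ∧ x' ≠ y' ∧ ¬ ∃ g ∈ G, g x = x' ∧ g y = y' := by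
  by_contra! hcon
  have hcard : 1 < Fintype.card Ω := by omega
  obtain ⟨x₀, y₀, hxy⟩ := Fintype.one_lt_card_iff.1 hcard
  have htrans : ∀ x x' : Ω, ∃ g ∈ G, g x = x' := fun x x' => by
    obtain ⟨y, hy⟩ := Fintype.exists_ne_of_one_lt_card hcard x
    obtain ⟨y', hy'⟩ := Fintype.exists_ne_of_one_lt_card hcard x'
    obtain ⟨g, hg, h1, -⟩ := hcon x y x' y' hy.symm hy'.symm
    exact ⟨g, hg, h1⟩
  -- Under double transitivity $E_1$ has one diagonal and one off-diagonal value, so it lies in the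
  -- span of $1$ and $J$. Its coefficients at $E_1$ and $E_2$ would then coincide, but they are $1$
  -- and $0$.
  have hE : D.comb 0 1 0 = D.comb (D.E₁ x₀ x₀ - D.E₁ x₀ y₀ + 3 * p * D.E₁ x₀ y₀)
      (D.E₁ x₀ x₀ - D.E₁ x₀ y₀) (D.E₁ x₀ x₀ - D.E₁ x₀ y₀) := by
    have : D.comb (D.E₁ x₀ x₀ - D.E₁ x₀ y₀ + 3 * p * D.E₁ x₀ y₀)
      (D.E₁ x₀ x₀ - D.E₁ x₀ y₀) (D.E₁ x₀ x₀ - D.E₁ x₀ y₀) =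
      (D.E₁ x₀ x₀ - D.E₁ x₀ y₀) • D.comb 1 1 1 + (D.E₁ x₀ y₀) • D.comb (3 * p) 0 0 := by
      rw [D.smul_comb, D.smul_comb, D.comb_add]
      congr 1 <;> ring
    rw [this, ← D.ones_eq hp hΩ, D.comb_one]
    ext x y
    have h01 : D.comb 0 1 0 x y = D.E₁ x y := by simp [comb]
    rw [h01]
    by_cases hxy' : x = y
    · subst hxy'
      obtain ⟨g, hg, h1⟩ := htrans x₀ x
      rw [← h1, D.inv₁ g hg]
      simp
    · obtain ⟨g, hg, h1, h2⟩ := hcon x₀ y₀ x y hxy hxy'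
      rw [← h1, ← h2, D.inv₁ g hg]
      have : g x₀ ≠ g y₀ := fun h => hxy (g.injective h)
      simp [this]
  obtain ⟨-, h1, h2⟩ := D.comb_inj hp hE
  exact one_ne_zero (h1.trans h2.symm)

end CentralIdempotents

end Graph

/-! ### Integrality of the eigenvalues and the possible parameters -/

theorem exists_int_eq_of_isIntegral {q : ℚ} (h : IsIntegral ℤ (q : ℂ)) : ∃ n : ℤ, q = n := by
  have h' : IsIntegral ℤ q := by
    rw [← isIntegral_algebraMap_iff (algebraMap ℚ ℂ).injective]
    simpa using h
  obtain ⟨n, hn⟩ := IsIntegrallyClosed.isIntegral_iff.1 h'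
  exact ⟨n, by simpa using hn.symm⟩

/-- Two numbers with rational weighted power sums of orders one, two and three are rational if the
weights are distinct. -/
theorem rational_of_power_sums {p : ℕ} (hp : 5 ≤ p) {s t : ℂ} {m₁ m₂ m₃ : ℚ}
    (h₁ : s * p + t * (2 * p - 1) = m₁) (h₂ : s ^ 2 * p + t ^ 2 * (2 * p - 1) = m₂)
    (h₃ : s ^ 3 * p + t ^ 3 * (2 * p - 1) = m₃) : ∃ a b : ℚ, s = a ∧ t = b := by
  have hp0 : (p : ℂ) ≠ 0 := by exact_mod_cast (by omega : p ≠ 0)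
  have hp1 : (p : ℂ) - 1 ≠ 0 := by rw [sub_ne_zero]; exact_mod_cast (by omega : p ≠ 1)
  have hp2 : (2 * p : ℂ) - 1 ≠ 0 := by rw [sub_ne_zero]; exact_mod_cast (by omega : 2 * p ≠ 1)
  have hp3 : (3 * p : ℂ) - 1 ≠ 0 := by rw [sub_ne_zero]; exact_mod_cast (by omega : 3 * p ≠ 1)
  have hu : ∃ u : ℚ, s - t = u := by
    by_cases h : s - t = 0
    · exact ⟨0, by simp [h]⟩
    -- Weighted variance and, in `e3`, weighted third central moment. Their quotient is rational and
    -- equals $(p-1)(s-t)$ up to rational factors; unequal weights make $p-1\neq0$.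
    have e2 : ((3 * p - 1) * m₂ - m₁ ^ 2 : ℂ) = p * (2 * p - 1) * (s - t) ^ 2 := by
      rw [← h₁, ← h₂]; ring
    have e3 : ((3 * p - 1) ^ 2 * m₃ - 3 * (3 * p - 1) * m₁ * m₂ + 2 * m₁ ^ 3 : ℂ) =
        p * (2 * p - 1) * (p - 1) * (s - t) ^ 3 := by
      rw [← h₁, ← h₂, ← h₃]; ring
    refine ⟨((3 * p - 1) ^ 2 * m₃ - 3 * (3 * p - 1) * m₁ * m₂ + 2 * m₁ ^ 3) /
      ((p - 1) * ((3 * p - 1) * m₂ - m₁ ^ 2)), ?_⟩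
    push_cast
    rw [e2, e3, eq_div_iff (mul_ne_zero hp1 (mul_ne_zero (mul_ne_zero hp0 hp2) (pow_ne_zero 2 h)))]
    ring
  obtain ⟨u, hu⟩ := hu
  have ht : t = ((m₁ - p * u) / (3 * p - 1) : ℚ) := by
    push_cast
    rw [eq_div_iff hp3, ← hu, ← h₁]
    ring
  exact ⟨(m₁ - p * u) / (3 * p - 1) + u, (m₁ - p * u) / (3 * p - 1), by
    rw [Rat.cast_add, ← ht, ← hu]; ring, ht⟩

/-- With $m=-s-2t$ one gets $k=t+pm$ and $pm(3-m)$ equal to a quadratic in $t$. Completing the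
square excludes $m<0$ and $m>3$; $m=0$ and $m=3$ would give $k=0$ and $k=3p-1$. The values $1$ and
$2$ belong to a graph and its complement. -/
theorem parameters_of_traces {p k s t : ℤ} (hp : 5 ≤ p) (hk : 0 < k) (hk' : k < 3 * p - 1)
    (h₁ : k + s * p + t * (2 * p - 1) = 0)
    (h₂ : k ^ 2 + s ^ 2 * p + t ^ 2 * (2 * p - 1) = 3 * p * k) :
    (k = p + t ∧ s = -1 - 2 * t ∧ 2 * p = 6 * t ^ 2 + 3 * t + 1) ∨
      (k = 2 * p + t ∧ s = -2 - 2 * t ∧ 2 * p = 6 * t ^ 2 + 9 * t + 4) := by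
  obtain ⟨m, hm⟩ : ∃ m, m = -s - 2 * t := ⟨_, rfl⟩
  have hs : s = -m - 2 * t := by linarith
  have hkm : k = t + p * m := by subst hs; linear_combination h₁
  subst hs hkm
  have key : p * m * (3 - m) = 6 * t ^ 2 + 6 * t * m - 3 * t + m ^ 2 := by
    have : p * (p * m * (3 - m)) = p * (6 * t ^ 2 + 6 * t * m - 3 * t + m ^ 2) := by
      linear_combination -h₂
    exact mul_left_cancel₀ (by omega) this
  rcases lt_or_ge m 1 with h | h
  · exfalso
    rcases eq_or_lt_of_le (Int.le_of_lt_add_one h : m ≤ 0) with h0 | h0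
    · subst h0
      have : t * (2 * t - 1) = 0 := by linarith
      rcases mul_eq_zero.1 this with h | h
      · subst h; simp at hk
      · omega
    · nlinarith [sq_nonneg (12 * t + 6 * m - 3)]
  rcases lt_or_ge 2 m with h' | h'
  · exfalso
    rcases eq_or_lt_of_le (Int.add_one_le_of_lt h' : 2 + 1 ≤ m) with h0 | h0
    · norm_num at h0
      subst h0
      have : (t + 1) * (2 * t + 3) = 0 := by linarith
      rcases mul_eq_zero.1 this with h | h
      · have : t = -1 := by linarith
        subst this; linarith
      · omega
    · nlinarith [sq_nonneg (12 * t + 6 * m - 3)]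
  interval_cases m
  · left; refine ⟨by ring, by ring, by linarith⟩
  · right; refine ⟨by ring, by ring, by linarith⟩

section Graph

variable {Ω : Type*} [Fintype Ω] [DecidableEq Ω] {p : ℕ} {G : Subgroup (Equiv.Perm Ω)}

namespace CentralIdempotents

variable (D : CentralIdempotents p G)

theorem aeval_comb (k s t : ℂ) (f : Polynomial ℤ) :
    Polynomial.aeval (D.comb k s t) f =
      D.comb (Polynomial.aeval k f) (Polynomial.aeval s f) (Polynomial.aeval t f) := by
  induction f using Polynomial.induction_on' with
  | add f g hf hg => simp only [map_add, hf, hg, D.comb_add]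
  | monomial n a =>
    have hpow : ∀ n : ℕ, D.comb k s t ^ n = D.comb (k ^ n) (s ^ n) (t ^ n) := fun n => by
      induction n with
      | zero => simp [D.comb_one]
      | succ n ih => rw [pow_succ, ih, D.comb_mul]; simp only [pow_succ]
    simp only [Polynomial.aeval_monomial, hpow]
    have : (algebraMap ℤ (Matrix Ω Ω ℂ)) a = D.comb a a a := by
      have := D.smul_comb a 1 1 1
      rw [D.comb_one, mul_one] at this
      rw [← this, Int.cast_smul_eq_zsmul]
      simp
    rw [this, D.comb_mul]
    simp

/-- By Cayley–Hamilton the monic integral characteristic polynomial of `M` kills the combination,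
hence each coefficient. -/
theorem isIntegral_of_comb_eq (hp : 5 ≤ p) {k s t : ℂ} {M : Matrix Ω Ω ℤ}
    (h : M.map (Int.cast : ℤ → ℂ) = D.comb k s t) : IsIntegral ℤ s ∧ IsIntegral ℤ t := by
  have h0 : Polynomial.aeval (D.comb k s t) M.charpoly = 0 := by
    have h1 := M.aeval_self_charpoly
    have h2 := congrArg (Algebra.ofId ℤ ℂ).mapMatrix h1
    rw [← Polynomial.aeval_algHom_apply, map_zero] at h2
    rw [← h]
    exact h2
  rw [D.aeval_comb] at h0
  obtain ⟨-, h1, h2⟩ := D.comb_eq_zero hp h0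
  exact ⟨⟨_, M.charpoly_monic, h1⟩, ⟨_, M.charpoly_monic, h2⟩⟩

theorem exists_int_of_comb_eq (hp : 5 ≤ p) {k : ℤ} {s t : ℂ} {M : Matrix Ω Ω ℤ}
    (h : M.map (Int.cast : ℤ → ℂ) = D.comb k s t) : ∃ a b : ℤ, s = a ∧ t = b := by
  have tr : ∀ N : Matrix Ω Ω ℤ, (N.map (Int.cast : ℤ → ℂ)).trace = (N.trace : ℂ) := fun N => by
    simp [Matrix.trace]
  have hmul : ∀ N N' : Matrix Ω Ω ℤ, (N * N').map (Int.cast : ℤ → ℂ) =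
      N.map Int.cast * N'.map Int.cast := fun N N' => Matrix.map_mul (f := Int.castRingHom ℂ)
  have h1 := tr M
  have h2 := tr (M * M)
  have h3 := tr (M * M * M)
  rw [h, D.trace_comb] at h1
  rw [hmul, h, D.comb_mul, D.trace_comb] at h2
  rw [hmul, hmul, h, D.comb_mul, D.comb_mul, D.trace_comb] at h3
  obtain ⟨a, b, ha, hb⟩ := rational_of_power_sums hp (s := s) (t := t)
    (m₁ := (M.trace - k : ℤ)) (m₂ := ((M * M).trace - k * k : ℤ))
    (m₃ := ((M * M * M).trace - k * k * k : ℤ))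
    (by push_cast; rw [← h1]; ring) (by push_cast; rw [← h2]; ring) (by push_cast; rw [← h3]; ring)
  obtain ⟨hs, ht⟩ := D.isIntegral_of_comb_eq hp h
  rw [ha] at hs
  rw [hb] at ht
  obtain ⟨a', rfl⟩ := exists_int_eq_of_isIntegral hs
  obtain ⟨b', rfl⟩ := exists_int_eq_of_isIntegral ht
  exact ⟨a', b', by simpa using ha, by simpa using hb⟩

end CentralIdempotents

end Graph

/-! ### The strongly regular graph of a group of Type II -/

section Graph

variable {Ω : Type*}

open Classical in
/-- The adjacency matrix of a relation. -/
noncomputable def adj (R : Ω → Ω → Prop) : Matrix Ω Ω ℤ :=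
  Matrix.of fun x y => if R x y then 1 else 0

theorem adj_of {R : Ω → Ω → Prop} {x y : Ω} (h : R x y) : adj R x y = 1 := if_pos h

theorem adj_of_not {R : Ω → Ω → Prop} {x y : Ω} (h : ¬ R x y) : adj R x y = 0 := if_neg h

theorem adj_congr {R S : Ω → Ω → Prop} {x y x' y' : Ω} (h : R x y ↔ S x' y') :
    adj R x y = adj S x' y' := by
  by_cases hS : S x' y'
  · rw [adj_of hS, adj_of (h.2 hS)]
  · rw [adj_of_not hS, adj_of_not (mt h.1 hS)]

theorem adj_eq_zero_or_one (R : Ω → Ω → Prop) (x y : Ω) : adj R x y = 0 ∨ adj R x y = 1 := by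
  by_cases h : R x y
  · exact Or.inr (adj_of h)
  · exact Or.inl (adj_of_not h)

theorem adj_mul_self (R : Ω → Ω → Prop) (x y : Ω) : adj R x y * adj R x y = adj R x y := by
  rcases adj_eq_zero_or_one R x y with h | h <;> rw [h] <;> rfl

/-- A strongly regular graph on `3 * p` points with the parameters forced by Type II, invariant
under `G`. The last condition expresses that a character of degree `p` takes integral values at the
permutations without fixed points. -/
structure TypeIIGraph [Fintype Ω] (p : ℕ) (G : Subgroup (Equiv.Perm Ω)) where
  R : Ω → Ω → Prop
  t : ℤ
  symm : ∀ {x y}, R x y → R y x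
  irrefl : ∀ x, ¬ R x x
  inv : ∀ g ∈ G, ∀ {x y}, R x y → R (g x) (g y)
  eq : 2 * (p : ℤ) = 6 * t ^ 2 + 3 * t + 1
  degree : ∀ x, ∑ y, adj R x y = p + t
  srg : ∀ x y, x ≠ y →
    ∑ w, adj R x w * adj R w y = (-1 - t) * adj R x y + (p - 2 * t ^ 2)
  dvd : ∀ z ∈ G, (∀ x, z x ≠ x) → (1 + 3 * t) ∣ ∑ x, adj R x (z x) - p

variable [Fintype Ω] [DecidableEq Ω] {p : ℕ} {G : Subgroup (Equiv.Perm Ω)}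

/-- The relation is an orbital or its complement. It is symmetric because $A-A^{T}$ is invariant and
antisymmetric, hence zero. -/
theorem CentralIdempotents.exists_relation (D : CentralIdempotents p G) (hp : 5 ≤ p)
    (hΩ : Fintype.card Ω = 3 * p) (hG : ∀ x y : Ω, ∃ g ∈ G, g x = y) :
    ∃ R : Ω → Ω → Prop, (∀ x y, R x y → R y x) ∧ (∀ x, ¬ R x x) ∧
      (∀ g ∈ G, ∀ x y, R x y → R (g x) (g y)) ∧ ∃ t : ℤ, 2 * (p : ℤ) = 6 * t ^ 2 + 3 * t + 1 ∧
        (adj R).map (Int.cast : ℤ → ℂ) = D.comb (p + t) (-1 - 2 * t) t := by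
  classical
  obtain ⟨x₀, y₀, x₁, y₁, hne, hne', hnot⟩ := D.exists_not_related hp hΩ
  let R : Ω → Ω → Prop := fun x y => ∃ g ∈ G, g x₀ = x ∧ g y₀ = y
  have hinv : ∀ g ∈ G, ∀ x y, R (g x) (g y) ↔ R x y := by
    intro g hg x y
    constructor
    · rintro ⟨h, hh, h1, h2⟩
      exact ⟨g⁻¹ * h, G.mul_mem (G.inv_mem hg) hh, by simp [h1], by simp [h2]⟩
    · rintro ⟨h, hh, h1, h2⟩
      exact ⟨g * h, G.mul_mem hg hh, by simp [h1], by simp [h2]⟩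
  have hirr : ∀ x, ¬ R x x := by
    rintro x ⟨g, -, h1, h2⟩
    exact hne (g.injective (h1.trans h2.symm))
  let A : Matrix Ω Ω ℂ := (adj R).map (Int.cast : ℤ → ℂ)
  have hA : IsInvariantMatrix G A := by
    intro g hg x y
    simp only [A, Matrix.map_apply, adj_congr (hinv g hg x y)]
  have hsymm : ∀ x y, R x y → R y x := by
    have h0 := D.eq_zero_of_transpose_eq_neg hp hΩ (A := A - A.transpose)
      (fun g hg x y => by
        simp only [Matrix.sub_apply, Matrix.transpose_apply, hA g hg])
      (by rw [Matrix.transpose_sub, Matrix.transpose_transpose, neg_sub])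
    intro x y hxy
    have h1 := congrFun (congrFun h0 y) x
    by_contra hyx
    simp [A, adj_of hxy, adj_of_not hyx] at h1
  have hsymm' : ∀ x y, adj R x y = adj R y x := fun x y =>
    adj_congr ⟨hsymm x y, hsymm y x⟩
  have hrow : ∀ x, ∑ y, adj R x y = ∑ y, adj R x₀ y := by
    intro x
    obtain ⟨g, hg, rfl⟩ := hG x₀ x
    rw [← Equiv.sum_comp g]
    exact Finset.sum_congr rfl fun y _ => adj_congr (hinv g hg x₀ y)
  set k := ∑ y, adj R x₀ y with hk
  obtain ⟨k', s, t, hst⟩ := D.exists_eq A hA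
  change A = D.comb k' s t at hst
  have hk' : k' = k := D.eq_of_row_sum hp hΩ hst fun x => by
    rw [← hrow x]; simp [A]
  subst hk'
  obtain ⟨s, t, rfl, rfl⟩ := D.exists_int_of_comb_eq hp hst
  have htr1 : A.trace = 0 := by
    simp [A, Matrix.trace, adj_of_not (hirr _)]
  have htr2 : (A * A).trace = 3 * p * k := by
    have : ((∑ x, ∑ y, adj R x y * adj R y x : ℤ) : ℂ) = 3 * p * k := by
      have h1 : ∀ x, ∑ y, adj R x y * adj R y x = k := fun x => by
        rw [← hrow x]
        exact Finset.sum_congr rfl fun y _ => by rw [hsymm' y x, adj_mul_self]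
      simp [h1, hΩ]
    rw [← this]
    simp [A, Matrix.trace, Matrix.mul_apply]
  rw [hst, D.trace_comb] at htr1
  rw [hst, D.comb_mul, D.trace_comb] at htr2
  have hkpos : 0 < k := by
    rw [hk]
    refine Finset.sum_pos' (fun y _ => ?_) ⟨y₀, Finset.mem_univ _, ?_⟩
    · rcases adj_eq_zero_or_one R x₀ y with h | h <;> simp [h]
    · rw [adj_of ⟨1, G.one_mem, rfl, rfl⟩]; simp
  have hklt : k < 3 * p - 1 := by
    rw [← hrow x₁]
    -- The two points not counted are `x₁` itself and `y₁`, which the chosen orbital misses.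
    have h1 : ∑ y, adj R x₁ y + 2 ≤ ∑ y : Ω, (1 : ℤ) := by
      have h2 : ∑ y, adj R x₁ y + ∑ y, ((if y = x₁ then 1 else 0) + (if y = y₁ then 1 else 0) : ℤ)
          ≤ ∑ y : Ω, (1 : ℤ) := by
        rw [← Finset.sum_add_distrib]
        refine Finset.sum_le_sum fun y _ => ?_
        by_cases h1 : y = x₁
        · subst h1; simp [adj_of_not (hirr _), hne']
        · by_cases h2 : y = y₁
          · subst h2; rw [adj_of_not hnot]; simp [hne'.symm]
          · rcases adj_eq_zero_or_one R x₁ y with h | h <;> simp [h, h1, h2]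
      rw [Finset.sum_add_distrib] at h2
      simpa using h2
    have h3 : (∑ y : Ω, (1 : ℤ)) = 3 * p := by simp [hΩ]
    omega
  rcases parameters_of_traces (p := p) (k := k) (s := s) (t := t) (by exact_mod_cast hp) hkpos hklt
    (by exact_mod_cast htr1) (by
      have : (k ^ 2 + s ^ 2 * p + t ^ 2 * (2 * p - 1) : ℂ) = 3 * p * k := by
        rw [← htr2]; ring
      exact_mod_cast this) with ⟨e1, e2, e3⟩ | ⟨e1, e2, e3⟩
  · refine ⟨R, hsymm, hirr, fun g hg x y => (hinv g hg x y).2, t, e3, ?_⟩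
    change A = _
    rw [hst, e1, e2]
    push_cast
    rfl
  -- The complement $J-1-A$ has eigenvalue $-1-t$ on the third summand, so this is its parameter.
  · refine ⟨fun x y => x ≠ y ∧ ¬ R x y, fun x y h => ⟨h.1.symm, fun h' => h.2 (hsymm _ _ h')⟩,
      fun x h => h.1 rfl, fun g hg x y h => ⟨fun h' => h.1 (g.injective h'),
        fun h' => h.2 ((hinv g hg x y).1 h')⟩, -1 - t, by linarith, ?_⟩
    have : (adj fun x y => x ≠ y ∧ ¬ R x y).map (Int.cast : ℤ → ℂ) =
        (Matrix.of fun _ _ => 1) - 1 - A := by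
      ext x y
      simp only [Matrix.map_apply, Matrix.sub_apply, Matrix.of_apply, A]
      by_cases hxy : x = y
      · subst hxy
        rw [adj_of_not (fun h => h.1 rfl), adj_of_not (hirr _)]
        simp
      · by_cases hR : R x y
        · rw [adj_of_not (fun h => h.2 hR), adj_of hR, Matrix.one_apply_ne hxy]
          simp
        · rw [adj_of ⟨hxy, hR⟩, adj_of_not hR, Matrix.one_apply_ne hxy]
          simp
    rw [this, D.ones_eq hp hΩ, ← D.comb_one, hst, D.comb_sub, D.comb_sub, e1, e2]
    congr 1 <;> push_cast <;> ring

theorem IsTypeII.nonempty_graph (hp5 : 5 ≤ p) (hΩ : Fintype.card Ω = 3 * p)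
    (hG : ∀ x y : Ω, ∃ g ∈ G, g x = y) (h : IsTypeII p G) : Nonempty (TypeIIGraph p G) := by
  classical
  obtain ⟨D⟩ := h.nonempty_centralIdempotents hp5 hΩ
  obtain ⟨R, hsymm, hirr, hinv, t, heq, hA⟩ := D.exists_relation hp5 hΩ hG
  have hentry : ∀ x y, ((adj R x y : ℤ) : ℂ) = D.comb (p + t) (-1 - 2 * t) t x y := fun x y => by
    rw [← hA]; rfl
  have heqC : (2 * p : ℂ) = 6 * t ^ 2 + 3 * t + 1 := by exact_mod_cast heq
  have ht : (1 + 3 * t : ℤ) ≠ 0 := by omega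
  refine ⟨⟨R, t, fun {x y} => hsymm x y, hirr, fun g hg {x y} => hinv g hg x y, heq, ?_, ?_, ?_⟩⟩
  · intro x
    have h1 : D.comb (p + t) (-1 - 2 * t) t * D.comb (3 * p) 0 0 =
        (p + t : ℂ) • D.comb (3 * p) 0 0 := by
      rw [D.comb_mul, D.smul_comb]; congr 1 <;> ring
    rw [← D.ones_eq hp5 hΩ, ← hA] at h1
    have h2 := congrFun (congrFun h1 x) x
    simp only [Matrix.mul_apply, Matrix.map_apply, Matrix.of_apply, mul_one, Matrix.smul_apply,
      smul_eq_mul] at h2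
    exact_mod_cast h2
  · intro x y hxy
    -- The quadratic $X^2+(1+t)X-t(1+2t)$ has the roots $t$ and $-1-2t$; the multiple of $J$
    -- corrects the value at $p+t$.
    have h1 : D.comb (p + t) (-1 - 2 * t) t * D.comb (p + t) (-1 - 2 * t) t =
        (-1 - t : ℂ) • D.comb (p + t) (-1 - 2 * t) t + (t * (1 + 2 * t) : ℂ) • D.comb 1 1 1
          + (p - 2 * t ^ 2 : ℂ) • D.comb (3 * p) 0 0 := by
      rw [D.comb_mul, D.smul_comb, D.smul_comb, D.smul_comb, D.comb_add, D.comb_add]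
      congr 1
      · linear_combination (-p : ℂ) * heqC
      · ring
      · ring
    rw [← D.ones_eq hp5 hΩ, ← hA, D.comb_one] at h1
    have h2 := congrFun (congrFun h1 x) y
    simp only [Matrix.mul_apply, Matrix.map_apply, Matrix.of_apply, mul_one, Matrix.smul_apply,
      smul_eq_mul, Matrix.add_apply, Matrix.one_apply_ne hxy, mul_zero, add_zero] at h2
    exact_mod_cast h2
  · intro z hz hfix
    have h1 := D.comb_trace (p + t) (-1 - 2 * t) t ⟨z, hz⟩
    have h2 := D.comb_trace 1 1 1 ⟨z, hz⟩
    rw [D.comb_one] at h2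
    have h3 : ∑ x, (1 : Matrix Ω Ω ℂ) x (z x) = 0 :=
      Finset.sum_eq_zero fun x _ => Matrix.one_apply_ne (hfix x).symm
    rw [h3] at h2
    simp only [← hentry] at h1
    set n := ∑ x, adj R x (z x) with hn
    have h4 : (n : ℂ) = p + t + (-1 - 2 * t) * D.χ₁ ⟨z, hz⟩ + t * D.χ₂ ⟨z, hz⟩ := by
      rw [← h1, hn]; push_cast; rfl
    have ht' : (1 + 3 * t : ℂ) ≠ 0 := by exact_mod_cast ht
    -- Without fixed points $1+\chi_1(z)+\chi_2(z)=0$; eliminating $\chi_2(z)$ shows that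
    -- $\chi_1(z)$ is rational.
    have h5 : D.χ₁ ⟨z, hz⟩ = ((p - n) / (1 + 3 * t) : ℚ) := by
      push_cast
      rw [eq_div_iff ht', h4]
      linear_combination (-t : ℂ) * h2
    obtain ⟨c, hc⟩ := exists_int_eq_of_isIntegral (h5 ▸ D.integral ⟨z, hz⟩)
    refine ⟨-c, ?_⟩
    rw [div_eq_iff (by exact_mod_cast ht)] at hc
    have : (p - n : ℤ) = c * (1 + 3 * t) := by exact_mod_cast hc
    linarith

end Graph

/-! ### Absence of modules of size $p$; coordinates adapted to $z$ -/

section Combinatorics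

variable {Ω : Type*} [Fintype Ω] {p : ℕ} {G : Subgroup (Equiv.Perm Ω)}

namespace TypeIIGraph

variable (Γ : TypeIIGraph p G)

theorem t_bounds (hp : 5 ≤ p) : 1 ≤ Γ.t ∨ Γ.t ≤ -2 := by
  have h := Γ.eq
  have hp' : (5 : ℤ) ≤ p := by exact_mod_cast hp
  by_contra! hcon
  obtain ⟨h1, h2⟩ := hcon
  have : Γ.t = 0 ∨ Γ.t = -1 := by omega
  rcases this with h0 | h0 <;> rw [h0] at h <;> omega

/-- This makes $1+3t$, which is nonzero, prime to $p$ and bounds $t$ against $p$. -/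
theorem abs_lt (hp : 5 ≤ p) : |1 + 3 * Γ.t| < p := by
  have h := Γ.eq
  rw [_root_.abs_lt]
  rcases Γ.t_bounds hp with ht | ht <;> constructor <;> nlinarith

theorem adj_comm (x y : Ω) : adj Γ.R x y = adj Γ.R y x := adj_congr ⟨Γ.symm, Γ.symm⟩

theorem adj_inv {g : Equiv.Perm Ω} (hg : g ∈ G) (x y : Ω) :
    adj Γ.R (g x) (g y) = adj Γ.R x y := by
  refine adj_congr ⟨fun h => ?_, Γ.inv g hg⟩
  have := Γ.inv g⁻¹ (G.inv_mem hg) h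
  simpa using this

/-- The prime $p$ divides one of the factors on the left. Both lie strictly between $-p$ and $2p$,
so that factor is $0$ or $p$; each of the four resulting values of $a$ turns the equation into a
vanishing product of nonzero integers. -/
theorem no_module_arith {p t a : ℤ} (ht : 1 ≤ t ∨ t ≤ -2) (hp : Prime p) (habs : |1 + 3 * t| < p)
    (ha : 0 ≤ a) (hap : a < p) (h : (a + 1 + 2 * t) * (a - t) = p * (a - t - 2 * t ^ 2)) :
    False := by
  obtain ⟨h1, h2⟩ := _root_.abs_lt.1 habs
  have hp0 : 0 < p := by omega
  have hrange : ∀ c, p ∣ c → -p < c → c < 2 * p → c = 0 ∨ c = p := by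
    rintro c ⟨d, rfl⟩ hc1 hc2
    have hd1 : -1 < d := by nlinarith
    have hd2 : d < 2 := by nlinarith
    interval_cases d
    · left; ring
    · right; ring
  have e : ∀ c d : ℤ, c * d = 0 → c ≠ 0 → d ≠ 0 → False := fun c d hcd hc hd =>
    (mul_ne_zero hc hd) hcd
  rcases hp.dvd_or_dvd (Dvd.intro _ h.symm) with hd | hd
  · rcases hrange _ hd (by omega) (by omega) with h0 | h0
    · have ha' : a = -1 - 2 * t := by linarith
      subst ha'
      refine e p ((1 + 2 * t) * (1 + t)) (by linarith) (by omega) (mul_ne_zero ?_ ?_) <;> omega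
    · have ha' : a = p - 1 - 2 * t := by linarith
      subst ha'
      refine e p (t * t) (by linarith) (by omega) (mul_ne_zero ?_ ?_) <;> omega
  · rcases hrange _ hd (by omega) (by omega) with h0 | h0
    · have ha' : a = t := by linarith
      subst ha'
      refine e p (a * a) (by linarith) (by omega) (mul_ne_zero ?_ ?_) <;> omega
    · have ha' : a = p + t := by linarith
      subst ha'
      refine e p ((1 + 2 * t) * (1 + t)) (by linarith) (by omega) (mul_ne_zero ?_ ?_) <;> omega

/-- No set of `p` points is such that every other point is joined to all or to none of them. -/
theorem no_module (hp : p.Prime) (hp5 : 5 ≤ p) (Δ : Finset Ω) (hΔ : Δ.card = p)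
    (h : ∀ y ∉ Δ, ∀ x ∈ Δ, ∀ x' ∈ Δ, Γ.R x y → Γ.R x' y) : False := by
  classical
  have hne : Δ.Nonempty := by rw [← Finset.card_pos, hΔ]; exact hp.pos
  obtain ⟨x₀, hx₀⟩ := hne
  have hout : ∀ x ∈ Δ, ∀ y ∉ Δ, adj Γ.R x y = adj Γ.R x₀ y := fun x hx y hy =>
    adj_congr ⟨h y hy x hx x₀ hx₀, h y hy x₀ hx₀ x hx⟩
  set o := ∑ y ∈ Δᶜ, adj Γ.R x₀ y with ho
  have hin : ∀ x ∈ Δ, ∑ y ∈ Δ, adj Γ.R x y = p + Γ.t - o := by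
    intro x hx
    -- All points of `Δ` have the same neighbours outside, so regularity makes the inner degree
    -- constant.
    rw [← Γ.degree x, ← Finset.sum_add_sum_compl Δ, ho]
    rw [Finset.sum_congr rfl fun y hy => hout x hx y (Finset.mem_compl.1 hy)]
    ring
  set a := ∑ y ∈ Δ, adj Γ.R x₀ y with ha
  have hao : p + Γ.t - o = a := (hin x₀ hx₀).symm
  have hx0 : adj Γ.R x₀ x₀ = 0 := adj_of_not (Γ.irrefl x₀)
  have hsplit : ∀ f : Ω → ℤ, ∑ y ∈ Δ, f y = f x₀ + ∑ y ∈ Δ.erase x₀, f y := fun f =>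
    (Finset.add_sum_erase Δ f hx₀).symm
  have hcard : ((Δ.erase x₀).card : ℤ) = p - 1 := by
    rw [Finset.card_erase_of_mem hx₀, hΔ, Nat.cast_sub hp.one_le, Nat.cast_one]
  have ha' : a = ∑ y ∈ Δ.erase x₀, adj Γ.R x₀ y := by
    rw [ha, hsplit, hx0, zero_add]
  have ha0 : 0 ≤ a := Finset.sum_nonneg fun y _ => by
    rcases adj_eq_zero_or_one Γ.R x₀ y with h | h <;> simp [h]
  have hap : a < p := by
    have : a ≤ ∑ y ∈ Δ.erase x₀, (1 : ℤ) := by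
      rw [ha']
      refine Finset.sum_le_sum fun y _ => ?_
      rcases adj_eq_zero_or_one Γ.R x₀ y with h | h <;> simp [h]
    rw [Finset.sum_const, nsmul_eq_mul, hcard] at this
    linarith
  -- Walks of length two from `x₀` into `Δ`, counted here by end point and in `e2` by middle point.
  have e1 : ∑ y ∈ Δ, ∑ w, adj Γ.R x₀ w * adj Γ.R w y =
      (p + Γ.t) + ((-1 - Γ.t) * a + (p - 1) * (p - 2 * Γ.t ^ 2)) := by
    rw [hsplit]
    congr 1
    · rw [← Γ.degree x₀]
      exact Finset.sum_congr rfl fun w _ => by rw [Γ.adj_comm w x₀, adj_mul_self]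
    · rw [Finset.sum_congr rfl fun y hy => Γ.srg x₀ y (Finset.ne_of_mem_erase hy).symm,
        Finset.sum_add_distrib, ← Finset.mul_sum, ← ha', Finset.sum_const, nsmul_eq_mul, hcard]
  have e2 : ∑ y ∈ Δ, ∑ w, adj Γ.R x₀ w * adj Γ.R w y = a * a + o * p := by
    rw [Finset.sum_comm, ← Finset.sum_add_sum_compl Δ]
    congr 1
    · rw [Finset.sum_congr rfl fun w hw => by rw [← Finset.mul_sum, hin w hw, hao],
        ← Finset.sum_mul]
    · rw [ho, Finset.sum_mul]
      refine Finset.sum_congr rfl fun w hw => ?_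
      rw [Finset.sum_congr rfl fun y hy => by
        rw [Γ.adj_comm w y, hout y hy w (Finset.mem_compl.1 hw), adj_mul_self],
        Finset.sum_const, nsmul_eq_mul, hΔ, mul_comm]
  refine no_module_arith (Γ.t_bounds hp5) (Nat.prime_iff_prime_int.1 hp) (Γ.abs_lt hp5) ha0 hap ?_
  have ho' : o = p + Γ.t - a := by linarith
  rw [e1, ho'] at e2
  linear_combination -e2

end TypeIIGraph

/-- A permutation of order `p` without fixed points on `3 * p` points is a translation in suitable
coordinates. -/
theorem exists_coordinates (hp : p.Prime) (hΩ : Fintype.card Ω = 3 * p) {z : Equiv.Perm Ω}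
    (hz : z ^ p = 1) (hfix : ∀ x, z x ≠ x) :
    ∃ e : Fin 3 × ZMod p ≃ Ω, ∀ i x, z (e (i, x)) = e (i, x + 1) := by
  classical
  have : Fact p.Prime := ⟨hp⟩
  have : NeZero p := ⟨hp.ne_zero⟩
  have hmod : ∀ a b : ℕ, (a : ZMod p) = b → z ^ a = z ^ b := fun a b hab => by
    rw [ZMod.natCast_eq_natCast_iff] at hab
    exact pow_eq_pow_iff_modEq.2 (hab.of_dvd (orderOf_dvd_of_pow_eq_one hz))
  have hfree : ∀ (d : ℕ) x, (z ^ d) x = x → (d : ZMod p) = 0 := fun d x hd => by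
    by_contra h0
    obtain ⟨m, hm⟩ := ZMod.natCast_zmod_surjective (d : ZMod p)⁻¹
    have h1 : z ^ (d * m) = z ^ 1 := hmod _ _ (by
      push_cast
      rw [hm, mul_inv_cancel₀ h0])
    apply hfix x
    have h2 : ∀ m : ℕ, ((z ^ d) ^ m) x = x := fun m => by
      induction m with
      | zero => simp
      | succ m ih => rw [pow_succ, Equiv.Perm.mul_apply, hd, ih]
    have h3 := h2 m
    rwa [← pow_mul, h1, pow_one] at h3
  let Q := Quotient (Equiv.Perm.SameCycle.setoid z)
  let f : Q × ZMod p → Ω := fun q => (z ^ q.2.val) q.1.out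
  have hf : Function.Bijective f := by
    constructor
    · rintro ⟨q, x⟩ ⟨q', x'⟩ h
      have h' : (z ^ x.val) q.out = (z ^ x'.val) q'.out := h
      have hq : q = q' := by
        rw [← q.out_eq, ← q'.out_eq]
        apply Quotient.sound
        change z.SameCycle _ _
        rw [← Equiv.Perm.sameCycle_pow_left (n := x.val), h', Equiv.Perm.sameCycle_pow_left]
      subst hq
      have h1 : (z ^ (x.val + (p - x'.val))) q.out = q.out := by
        rw [add_comm, pow_add, Equiv.Perm.mul_apply, h', ← Equiv.Perm.mul_apply, ← pow_add,
          Nat.sub_add_cancel (ZMod.val_lt x').le, hz, Equiv.Perm.one_apply]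
      have h2 := hfree _ _ h1
      rw [Nat.cast_add, Nat.cast_sub (ZMod.val_lt x').le] at h2
      simp only [ZMod.natCast_val, ZMod.cast_id', id_eq, CharP.cast_eq_zero, zero_sub] at h2
      rw [← sub_eq_add_neg, sub_eq_zero] at h2
      rw [h2]
    · intro w
      let q : Q := Quotient.mk _ w
      have h1 : z.SameCycle q.out w := Quotient.exact q.out_eq
      obtain ⟨n, hn⟩ := h1.exists_nat_pow_eq
      refine ⟨(q, (n : ZMod p)), ?_⟩
      change (z ^ (n : ZMod p).val) q.out = w
      rw [hmod _ n (by simp), hn]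
  have hcard : Fintype.card Q = 3 := by
    have h1 := Fintype.card_of_bijective hf
    rw [Fintype.card_prod, ZMod.card, hΩ] at h1
    exact Nat.eq_of_mul_eq_mul_right hp.pos h1
  let e₀ : Fin 3 ≃ Q := (Fintype.equivFinOfCardEq hcard).symm
  refine ⟨(Equiv.prodCongr e₀ (Equiv.refl _)).trans (Equiv.ofBijective f hf), fun i x => ?_⟩
  change z ((z ^ x.val) (e₀ i).out) = (z ^ (x + 1).val) (e₀ i).out
  rw [← Equiv.Perm.mul_apply, ← pow_succ', hmod (x.val + 1) (x + 1).val (by simp)]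

end Combinatorics

/-- A sum over `ZMod p` of a function invariant under multiplication by a unit. -/
theorem orderOf_dvd_sum_sub {p : ℕ} [Fact p.Prime] (l : (ZMod p)ˣ) (F : ZMod p → ℤ)
    (hF : ∀ d, F (l * d) = F d) : (orderOf l : ℤ) ∣ ∑ d, F d - F 0 := by
  classical
  have h1 : ∑ d, F d - F 0 = ∑ u : (ZMod p)ˣ, F u := by
    rw [← Finset.add_sum_erase Finset.univ F (Finset.mem_univ 0), add_sub_cancel_left]
    symm
    refine Finset.sum_bij (fun u _ => (u : ZMod p)) (fun u _ => by simp) (fun u _ v _ h => ?_)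
      (fun d hd => ?_) (fun _ _ => rfl)
    · exact Units.ext h
    · exact ⟨Units.mk0 d (Finset.ne_of_mem_erase hd), Finset.mem_univ _, rfl⟩
  have h2 : ∀ n : ℕ, ∀ d, F ((l : ZMod p) ^ n * d) = F d := fun n => by
    induction n with
    | zero => simp
    | succ n ih => intro d; rw [pow_succ', mul_assoc, hF, ih]
  have h3 : ∀ m ∈ Subgroup.zpowers l, ∀ d, F (m * d) = F d := fun m hm d => by
    obtain ⟨n, rfl⟩ := (mem_powers_iff_mem_zpowers.2 hm : m ∈ Submonoid.powers l)
    simpa using h2 n d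
  -- The units split into cosets of $\langle l\rangle$, each of size `orderOf l`, and `F` is
  -- constant on every coset.
  rw [h1, ← Equiv.sum_comp (Subgroup.groupEquivQuotientProdSubgroup (s := Subgroup.zpowers l)).symm,
    Fintype.sum_prod_type]
  refine Finset.dvd_sum fun q _ => ?_
  have h4 : ∀ m : Subgroup.zpowers l,
      F ((Subgroup.groupEquivQuotientProdSubgroup (s := Subgroup.zpowers l)).symm (q, m) : (ZMod p)ˣ)
        = F ((Subgroup.groupEquivQuotientProdSubgroup (s := Subgroup.zpowers l)).symm (q, 1) :
          (ZMod p)ˣ) := fun m => by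
    set a := (Subgroup.groupEquivQuotientProdSubgroup (s := Subgroup.zpowers l)).symm (q, m)
    set b := (Subgroup.groupEquivQuotientProdSubgroup (s := Subgroup.zpowers l)).symm (q, 1)
    have hab : (QuotientGroup.mk b : (ZMod p)ˣ ⧸ Subgroup.zpowers l) = QuotientGroup.mk a := by
      have key : ∀ m, (QuotientGroup.mk ((Subgroup.groupEquivQuotientProdSubgroup
          (s := Subgroup.zpowers l)).symm (q, m)) : (ZMod p)ˣ ⧸ Subgroup.zpowers l) = q := by
        intro m
        have h5 := (Subgroup.groupEquivQuotientProdSubgroup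
          (s := Subgroup.zpowers l)).apply_symm_apply (q, m)
        exact congrArg Prod.fst h5
      rw [key, key]
    rw [QuotientGroup.eq] at hab
    have := h3 _ hab b
    rw [← Units.val_mul, mul_comm, mul_inv_cancel_left] at this
    exact this
  rw [Finset.sum_congr rfl fun m _ => h4 m, Finset.sum_const, nsmul_eq_mul, Finset.card_univ,
    Fintype.card_zpowers]
  exact Dvd.intro _ rfl

/-! ### Counting edges between the three blocks -/

section Blocks

variable {Ω : Type*} {p : ℕ}

theorem pow_apply_coordinates {z : Equiv.Perm Ω} {e : Fin 3 × ZMod p ≃ Ω}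
    (he : ∀ i x, z (e (i, x)) = e (i, x + 1)) (n : ℕ) (i : Fin 3) (x : ZMod p) :
    (z ^ n) (e (i, x)) = e (i, x + n) := by
  induction n with
  | zero => simp
  | succ n ih => rw [pow_succ', Equiv.Perm.mul_apply, ih, he]; push_cast; rw [add_assoc]

namespace TypeIIGraph

variable [Fintype Ω] {G : Subgroup (Equiv.Perm Ω)} (Γ : TypeIIGraph p G)
  {z : Equiv.Perm Ω} {e : Fin 3 × ZMod p ≃ Ω}

theorem adj_translate [NeZero p] (hz : z ∈ G) (he : ∀ i x, z (e (i, x)) = e (i, x + 1))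
    (i j : Fin 3) (x y c : ZMod p) :
    adj Γ.R (e (i, x + c)) (e (j, y + c)) = adj Γ.R (e (i, x)) (e (j, y)) := by
  obtain ⟨n, rfl⟩ := ZMod.natCast_zmod_surjective c
  rw [← pow_apply_coordinates he, ← pow_apply_coordinates he, Γ.adj_inv (G.pow_mem hz n)]

/-- The number of neighbours of a point of one block in another block. -/
noncomputable def blockCount [NeZero p] (e : Fin 3 × ZMod p ≃ Ω) (i j : Fin 3) : ℤ :=
  ∑ d, adj Γ.R (e (i, 0)) (e (j, d))

theorem blockCount_eq_of_shift [NeZero p] (e : Fin 3 × ZMod p ≃ Ω) (i j : Fin 3) (c : ZMod p) :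
    Γ.blockCount e i j = ∑ d, adj Γ.R (e (i, 0)) (e (j, d + c)) :=
  (Equiv.sum_comp (Equiv.addRight c) fun d => adj Γ.R (e (i, 0)) (e (j, d))).symm

theorem blockCount_comm [NeZero p] (hz : z ∈ G) (he : ∀ i x, z (e (i, x)) = e (i, x + 1))
    (i j : Fin 3) : Γ.blockCount e i j = Γ.blockCount e j i := by
  rw [blockCount, blockCount, ← Equiv.sum_comp (Equiv.neg (ZMod p))]
  refine Finset.sum_congr rfl fun d _ => ?_
  rw [Γ.adj_comm, ← Γ.adj_translate hz he j i _ _ d]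
  simp

theorem sum_blockCount [NeZero p] (i : Fin 3) : ∑ j, Γ.blockCount e i j = p + Γ.t := by
  rw [← Γ.degree (e (i, 0)), ← Equiv.sum_comp e, Fintype.sum_prod_type]
  rfl

/-- Each nonzero difference occurs in exactly one of the diagonal blocks. -/
theorem sum_adj_diag [NeZero p] (hp : p.Prime) (hp5 : 5 ≤ p) (hz : z ∈ G)
    (he : ∀ i x, z (e (i, x)) = e (i, x + 1)) {d : ZMod p} (hd : d ≠ 0) :
    ∑ i, adj Γ.R (e (i, 0)) (e (i, d)) = 1 := by
  obtain ⟨n, rfl⟩ := ZMod.natCast_zmod_surjective d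
  have h1 := Γ.dvd (z ^ n) (G.pow_mem hz n) (fun w => by
    obtain ⟨⟨i, x⟩, rfl⟩ := e.surjective w
    rw [pow_apply_coordinates he]
    simpa using hd)
  set N := ∑ i, adj Γ.R (e (i, 0)) (e (i, (n : ZMod p))) with hN
  have h2 : ∑ x, adj Γ.R x ((z ^ n) x) = p * N := by
    rw [← Equiv.sum_comp e, Fintype.sum_prod_type, hN, Finset.mul_sum]
    refine Finset.sum_congr rfl fun i _ => ?_
    have h3 : ∀ x, adj Γ.R (e (i, x)) ((z ^ n) (e (i, x))) =
        adj Γ.R (e (i, 0)) (e (i, (n : ZMod p))) := fun x => by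
      rw [pow_apply_coordinates he, ← Γ.adj_translate hz he i i 0 _ x, zero_add, add_comm]
    rw [Finset.sum_congr rfl fun x _ => h3 x, Finset.sum_const, Finset.card_univ,
      ZMod.card, nsmul_eq_mul]
  rw [h2] at h1
  -- The factor $p$ cancels. Since $0\le N\le3$ and $|1+3t|\ge4$, the divisibility leaves only
  -- $N=1$.
  have h3 : (1 + 3 * Γ.t) ∣ (N - 1) := by
    have h4 : IsCoprime (1 + 3 * Γ.t) (p : ℤ) := by
      rw [isCoprime_comm, (Nat.prime_iff_prime_int.1 hp).coprime_iff_not_dvd]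
      intro h5
      have h6 := Int.eq_zero_of_abs_lt_dvd h5 (Γ.abs_lt hp5)
      omega
    refine h4.dvd_of_dvd_mul_left ?_
    rwa [mul_sub, mul_one]
  have hbound : ∀ i, 0 ≤ adj Γ.R (e (i, 0)) (e (i, (n : ZMod p))) ∧
      adj Γ.R (e (i, 0)) (e (i, (n : ZMod p))) ≤ 1 := fun i => by
    rcases adj_eq_zero_or_one Γ.R (e (i, 0)) (e (i, (n : ZMod p))) with h | h <;> simp [h]
  have b0 := hbound 0
  have b1 := hbound 1
  have b2 := hbound 2
  rw [Fin.sum_univ_three] at hN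
  have h7 : |N - 1| < |1 + 3 * Γ.t| := by
    have h8 : |N - 1| ≤ 2 := by rw [abs_le]; constructor <;> omega
    have h9 : 4 ≤ |1 + 3 * Γ.t| := by
      rcases Γ.t_bounds hp5 with h | h
      · exact le_trans (by omega) (le_abs_self _)
      · exact le_trans (by omega) (neg_le_abs _)
    omega
  have h10 := Int.eq_zero_of_abs_lt_dvd ((abs_dvd _ _).2 h3) h7
  omega

theorem sum_blockCount_diag [NeZero p] (hp : p.Prime) (hp5 : 5 ≤ p) (hz : z ∈ G)
    (he : ∀ i x, z (e (i, x)) = e (i, x + 1)) : ∑ i, Γ.blockCount e i i = p - 1 := by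
  classical
  simp only [blockCount]
  rw [Finset.sum_comm, ← Finset.add_sum_erase Finset.univ _ (Finset.mem_univ 0),
    Finset.sum_congr rfl fun d hd => Γ.sum_adj_diag hp hp5 hz he (Finset.ne_of_mem_erase hd),
    Finset.sum_eq_zero fun i _ => adj_of_not (Γ.irrefl _), Finset.sum_const,
    Finset.card_erase_of_mem (Finset.mem_univ _), Finset.card_univ, ZMod.card, nsmul_eq_mul,
    Nat.cast_sub hp.one_le]
  simp

/-- A permutation acting on each block as a translation translates all blocks by the same
amount. -/
theorem translation_const [NeZero p] (Γ : TypeIIGraph p G) (hp : p.Prime) (hp5 : 5 ≤ p)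
    (hz : z ∈ G) (he : ∀ i x, z (e (i, x)) = e (i, x + 1)) {g : Equiv.Perm Ω} (hg : g ∈ G)
    {b : Fin 3 → ZMod p} (hb : ∀ i x, g (e (i, x)) = e (i, x + b i)) (i j : Fin 3) :
    b i = b j := by
  classical
  have : Fact p.Prime := ⟨hp⟩
  have isolated : ∀ i, ¬ ∀ j, j ≠ i → b i ≠ b j := by
    intro i hi
    refine Γ.no_module hp hp5 (Finset.univ.image fun x => e (i, x)) ?_ ?_
    · rw [Finset.card_image_of_injective _ fun x y h => by simpa using h, Finset.card_univ,
        ZMod.card]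
    · intro w hw v hv v' hv' hR
      obtain ⟨⟨j, y⟩, rfl⟩ := e.surjective w
      obtain ⟨x, -, rfl⟩ := Finset.mem_image.1 hv
      obtain ⟨x', -, rfl⟩ := Finset.mem_image.1 hv'
      have hji : j ≠ i := by
        rintro rfl
        exact hw (Finset.mem_image_of_mem _ (Finset.mem_univ y))
      have hne : b i - b j ≠ 0 := sub_ne_zero.2 (hi j hji)
      -- Apply `g` and translate back by `b j`: the point of block `j` stays put while block `i`
      -- moves by the nonzero amount `b i - b j`, whose multiples exhaust `ZMod p`.
      have hstep : ∀ x, adj Γ.R (e (i, x + (b i - b j))) (e (j, y)) =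
          adj Γ.R (e (i, x)) (e (j, y)) := fun x => by
        rw [← Γ.adj_inv hg (e (i, x)), hb, hb, ← Γ.adj_translate hz he i j _ _ (b j)]
        congr 3
        ring
      have hsteps : ∀ n : ℕ, adj Γ.R (e (i, x + n * (b i - b j))) (e (j, y)) =
          adj Γ.R (e (i, x)) (e (j, y)) := fun n => by
        induction n with
        | zero => simp
        | succ n ih => rw [← ih, ← hstep (x + n * (b i - b j))]; congr 3; push_cast; ring
      obtain ⟨n, hn⟩ := ZMod.natCast_zmod_surjective ((x' - x) / (b i - b j))
      have h1 := hsteps n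
      rw [hn, div_mul_cancel₀ _ hne, add_sub_cancel, adj_of hR] at h1
      by_contra hcon
      rw [adj_of_not hcon] at h1
      exact zero_ne_one h1
  -- Among three values not all equal, one differs from both others.
  have h01 : b 0 = b 1 := by
    by_contra h
    by_cases h' : b 0 = b 2
    · apply isolated 1
      intro j hj
      fin_cases j
      · exact fun h'' => h h''.symm
      · exact absurd rfl hj
      · exact fun h'' => h (h'.trans h''.symm)
    · apply isolated 0
      intro j hj
      fin_cases j
      · exact absurd rfl hj
      · exact h
      · exact h'
  have h02 : b 0 = b 2 := by
    by_contra h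
    apply isolated 2
    intro j hj
    fin_cases j
    · exact fun h'' => h h''.symm
    · exact fun h'' => h (h01.trans h''.symm)
    · exact absurd rfl hj
  have key : ∀ i, b i = b 0 := fun i => by
    fin_cases i
    · rfl
    · exact h01.symm
    · exact h02.symm
  rw [key i, key j]

theorem adj_affine [NeZero p] (hz : z ∈ G) (he : ∀ i x, z (e (i, x)) = e (i, x + 1))
    {g : Equiv.Perm Ω} (hg : g ∈ G) {σ : Equiv.Perm (Fin 3)} {l : (ZMod p)ˣ} {b : Fin 3 → ZMod p}
    (hb : ∀ i x, g (e (i, x)) = e (σ i, l * x + b i)) (i j : Fin 3) (d : ZMod p) :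
    adj Γ.R (e (σ i, 0)) (e (σ j, l * d + (b j - b i))) = adj Γ.R (e (i, 0)) (e (j, d)) := by
  rw [← Γ.adj_inv hg (e (i, 0)), hb, hb, ← Γ.adj_translate hz he (σ i) (σ j) _ _ (b i)]
  congr 3 <;> ring

theorem blockCount_affine [NeZero p] (hz : z ∈ G) (he : ∀ i x, z (e (i, x)) = e (i, x + 1))
    {g : Equiv.Perm Ω} (hg : g ∈ G) {σ : Equiv.Perm (Fin 3)} {l : (ZMod p)ˣ} {b : Fin 3 → ZMod p}
    (hb : ∀ i x, g (e (i, x)) = e (σ i, l * x + b i)) (i j : Fin 3) :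
    Γ.blockCount e (σ i) (σ j) = Γ.blockCount e i j := by
  rw [Γ.blockCount_eq_of_shift e (σ i) (σ j) (b j - b i), ← Equiv.sum_comp (Units.mulLeft l)]
  exact Finset.sum_congr rfl fun d _ => Γ.adj_affine hz he hg hb i j d

/-- No affine map permutes the three blocks cyclically. -/
theorem not_three_cycle [NeZero p] (Γ : TypeIIGraph p G) (hp : p.Prime) (hp5 : 5 ≤ p)
    (hz : z ∈ G) (he : ∀ i x, z (e (i, x)) = e (i, x + 1)) {g : Equiv.Perm Ω} (hg : g ∈ G)
    {σ : Equiv.Perm (Fin 3)} {l : (ZMod p)ˣ} {b : Fin 3 → ZMod p}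
    (hb : ∀ i x, g (e (i, x)) = e (σ i, l * x + b i)) : orderOf σ ≠ 3 := by
  intro hσ
  have h3 : σ ^ 3 = 1 := by rw [← pow_orderOf_eq_one σ, hσ]
  have h1 : σ ≠ 1 := by rintro rfl; simp at hσ
  have key : ∀ σ : Equiv.Perm (Fin 3), σ ^ 3 = 1 → σ ≠ 1 →
      (σ 0 = 1 ∧ σ 1 = 2) ∨ (σ 0 = 2 ∧ σ 2 = 1) := by decide
  have c := fun i => Γ.blockCount_affine hz he hg hb i i
  have hdiag := Γ.sum_blockCount_diag hp hp5 hz he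
  rw [Fin.sum_univ_three] at hdiag
  -- Equal diagonal counts give $p\equiv1\pmod3$, whereas this equation gives $2p\equiv1\pmod3$.
  have heq := Γ.eq
  have h0 : Γ.blockCount e 0 0 = Γ.blockCount e 1 1 ∧
      Γ.blockCount e 0 0 = Γ.blockCount e 2 2 := by
    rcases key σ h3 h1 with ⟨e1, e2⟩ | ⟨e1, e2⟩
    · have c0 := c 0
      have c1 := c 1
      rw [e1] at c0
      rw [e2] at c1
      exact ⟨c0.symm, (c1.trans c0).symm⟩
    · have c0 := c 0
      have c2 := c 2
      rw [e1] at c0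
      rw [e2] at c2
      exact ⟨(c2.trans c0).symm, c0.symm⟩
  obtain ⟨h4, h5⟩ := h0
  omega

/-- Modulo $q$ one has $p\equiv1$, and the row sums say that the pairwise sums of the $e_i$ are all
$\equiv t+1$; unless the $e_i$ are equal, $q\mid1$. Moreover $x+y+w=3t^2+3t+1$. If all $e_i=0$, then
$t\equiv-1$ and $1\equiv0$; if all $e_i=1$, then $t\equiv1$ and $7\equiv3$. -/
theorem dvd_four_arith {q p t a₀ a₁ a₂ x y w e₁ e₂ e₃ : ℤ} (heq : 2 * p = 6 * t ^ 2 + 3 * t + 1)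
    (h₀ : a₀ + x + y = p + t) (h₁ : a₁ + x + w = p + t) (h₂ : a₂ + y + w = p + t)
    (hd : a₀ + a₁ + a₂ = p - 1) (d₀ : q ∣ a₀) (d₁ : q ∣ a₁) (d₂ : q ∣ a₂)
    (dx : q ∣ x - e₁) (dy : q ∣ y - e₂) (dw : q ∣ w - e₃)
    (he₁ : e₁ = 0 ∨ e₁ = 1) (he₂ : e₂ = 0 ∨ e₂ = 1) (he₃ : e₃ = 0 ∨ e₃ = 1) : q ∣ 4 := by
  obtain ⟨α₀, rfl⟩ := d₀
  obtain ⟨α₁, rfl⟩ := d₁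
  obtain ⟨α₂, rfl⟩ := d₂
  obtain ⟨β₁, hx⟩ := dx
  obtain ⟨β₂, hy⟩ := dy
  obtain ⟨β₃, hw⟩ := dw
  have hx' : x = e₁ + q * β₁ := by linarith
  have hy' : y = e₂ + q * β₂ := by linarith
  have hw' : w = e₃ + q * β₃ := by linarith
  subst hx' hy' hw'
  have hone : q ∣ 1 → q ∣ 4 := fun h => h.trans (by norm_num)
  have h12 : q ∣ e₁ - e₂ := ⟨α₂ - α₁ + β₂ - β₁, by linear_combination h₁ - h₂⟩
  have h23 : q ∣ e₂ - e₃ := ⟨α₁ - α₀ + β₃ - β₂, by linear_combination h₀ - h₁⟩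
  have ht : q ∣ t + 1 - (e₁ + e₂) :=
    ⟨α₀ + β₁ + β₂ - (α₀ + α₁ + α₂), by linear_combination hd - h₀⟩
  have hsum : q ∣ 3 * t ^ 2 + 3 * t + 1 - (e₁ + e₂ + e₃) := by
    refine ⟨β₁ + β₂ + β₃, ?_⟩
    have : 2 * (3 * t ^ 2 + 3 * t + 1 - (e₁ + e₂ + e₃)) = 2 * (q * (β₁ + β₂ + β₃)) := by
      linear_combination -heq - h₀ - h₁ - h₂ + hd
    linarith
  rcases he₁ with rfl | rfl <;> rcases he₂ with rfl | rfl <;> rcases he₃ with rfl | rfl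
  · refine hone ((Int.dvd_iff_dvd_of_dvd_sub ?_).1 hsum)
    rw [show 3 * t ^ 2 + 3 * t + 1 - (0 + 0 + 0) - 1 = 3 * t * (t + 1 - (0 + 0)) by ring]
    exact ht.mul_left _
  · exact hone (by simpa using h23)
  · exact hone (by simpa using h12)
  · exact hone (by simpa using h12)
  · exact hone (by simpa using h12)
  · exact hone (by simpa using h12)
  · exact hone (by simpa using h23)
  · refine (Int.dvd_iff_dvd_of_dvd_sub ?_).1 hsum
    rw [show 3 * t ^ 2 + 3 * t + 1 - (1 + 1 + 1) - 4 = 3 * (t + 2) * (t + 1 - (1 + 1)) by ring]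
    exact ht.mul_left _

/-- An affine map fixing the three blocks has a multiplier of order dividing `4`. -/
theorem orderOf_dvd_four [NeZero p] (Γ : TypeIIGraph p G) (hp : p.Prime) (hp5 : 5 ≤ p)
    (hz : z ∈ G) (he : ∀ i x, z (e (i, x)) = e (i, x + 1)) {g : Equiv.Perm Ω} (hg : g ∈ G)
    {l : (ZMod p)ˣ}
    {b : Fin 3 → ZMod p} (hb : ∀ i x, g (e (i, x)) = e (i, l * x + b i)) : orderOf l ∣ 4 := by
  have : Fact p.Prime := ⟨hp⟩
  by_cases hl : l = 1
  · simp [hl]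
  have hl' : (1 - l : ZMod p) ≠ 0 := fun h => hl (Units.ext (sub_eq_zero.1 h).symm)
  -- The coordinate of the fixed point of `g` in block `i`. Recentred at these points, `g` is
  -- multiplication by `l` on differences.
  let f : Fin 3 → ZMod p := fun i => b i / (1 - l)
  have hf : ∀ i, b i = f i - l * f i := fun i => by
    simp only [f]; field_simp
  have hd : ∀ i j, (orderOf l : ℤ) ∣
      Γ.blockCount e i j - adj Γ.R (e (i, 0)) (e (j, f j - f i)) := fun i j => by
    rw [Γ.blockCount_eq_of_shift e i j (f j - f i)]
    have := orderOf_dvd_sum_sub l (fun d => adj Γ.R (e (i, 0)) (e (j, d + (f j - f i))))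
      (fun d => by
        rw [← Γ.adj_affine hz he hg (σ := 1) hb i j (d + (f j - f i)), hf i, hf j]
        simp only [Equiv.Perm.one_apply]
        congr 3
        ring)
    simpa using this
  have hdiag : ∀ i, (orderOf l : ℤ) ∣ Γ.blockCount e i i := fun i => by
    have := hd i i
    rwa [sub_self, adj_of_not (Γ.irrefl _), sub_zero] at this
  have hrow := Γ.sum_blockCount (e := e)
  simp only [Fin.sum_univ_three] at hrow
  have hsum := Γ.sum_blockCount_diag hp hp5 hz he
  rw [Fin.sum_univ_three] at hsum
  have hcomm := Γ.blockCount_comm hz he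
  have h0 := hrow 0
  have h1 := hrow 1
  have h2 := hrow 2
  rw [hcomm 1 0] at h1
  rw [hcomm 2 0, hcomm 2 1] at h2
  have := dvd_four_arith Γ.eq (by linarith) (by linarith) (by linarith) hsum (hdiag 0) (hdiag 1)
    (hdiag 2) (hd 0 1) (hd 0 2) (hd 1 2) (adj_eq_zero_or_one _ _ _) (adj_eq_zero_or_one _ _ _)
    (adj_eq_zero_or_one _ _ _)
  exact_mod_cast this

end TypeIIGraph

end Blocks

/-! ### Sylow subgroups in degree $3p$ -/

section PGroup

open MulAction

variable {H X : Type*} [Group H] [Finite H] [MulAction H X] {p : ℕ} [Fact p.Prime]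

theorem stabilizer_normal_of_index (hH : IsPGroup p H) {x : X}
    (hx : (stabilizer H x).index = p) : (stabilizer H x).Normal := by
  apply Subgroup.normal_of_index_eq_minFac_card
  obtain ⟨n, hn⟩ := IsPGroup.iff_card.1 hH
  have hn0 : n ≠ 0 := by
    rintro rfl
    have h1 := (stabilizer H x).index_dvd_card
    rw [hx, hn, pow_zero] at h1
    exact (Fact.out : p.Prime).one_lt.ne' (Nat.dvd_one.1 h1)
  rw [hx, hn, (Fact.out : p.Prime).pow_minFac hn0]

/-- A `p`-group acting faithfully with all stabilizers of index `p` is elementary abelian. -/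
theorem pow_eq_one_and_commute [FaithfulSMul H X] (hH : IsPGroup p H)
    (hx : ∀ x : X, (stabilizer H x).index = p) (a b : H) : a ^ p = 1 ∧ a * b = b * a := by
  constructor
  · apply eq_of_smul_eq_smul (α := X)
    intro x
    have := stabilizer_normal_of_index hH (hx x)
    have h1 := (stabilizer H x).pow_index_mem a
    rw [hx x] at h1
    rw [one_smul]
    exact h1
  · apply eq_of_smul_eq_smul (α := X)
    intro x
    have := stabilizer_normal_of_index hH (hx x)
    have hcard : Nat.card (H ⧸ stabilizer H x) = p := hx x
    have := isCyclic_of_prime_card hcard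
    have h1 : (QuotientGroup.mk (b * a) : H ⧸ stabilizer H x) = QuotientGroup.mk (a * b) := by
      let _ := IsCyclic.commGroup (α := H ⧸ stabilizer H x)
      rw [QuotientGroup.mk_mul, QuotientGroup.mk_mul]
      exact IsCyclic.commGroup.mul_comm _ _
    rw [QuotientGroup.eq, mem_stabilizer_iff, mul_smul, inv_smul_eq_iff] at h1
    exact h1

/-- A `p`-group acting on `3 * p` points, `5 ≤ p`, with all stabilizers of index `p` contains an
element without fixed points. -/
theorem exists_smul_ne [Fintype X] (hp5 : 5 ≤ p) (hX : Fintype.card X = 3 * p) (hH : IsPGroup p H)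
    (hx : ∀ x : X, (stabilizer H x).index = p) : ∃ z : H, ∀ x : X, z • x ≠ x := by
  classical
  by_contra! hcon
  have := Fintype.ofFinite H
  have hstab : ∀ x : X, (Finset.univ.filter fun g : H => g • x = x).card * p = Fintype.card H := by
    intro x
    have h1 := (stabilizer H x).card_mul_index
    rw [hx x, Nat.card_eq_fintype_card (α := H)] at h1
    rw [← h1, Nat.card_eq_fintype_card]
    congr 1
    rw [← Fintype.card_subtype]
    exact Fintype.card_congr (Equiv.refl _)
  -- A stabilizer is normal, so an element fixing a point fixes its whole orbit of `p` points.
  -- Double counting fixed points then gives $|H|\,p\le3|H|$, contrary to $p\ge5$.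
  have hfix : ∀ g : H, p ≤ (Finset.univ.filter fun x : X => g • x = x).card := by
    intro g
    obtain ⟨x, hgx⟩ := hcon g
    have hN := stabilizer_normal_of_index hH (hx x)
    have h1 : (orbit H x).ncard = p := by rw [← index_stabilizer, hx x]
    rw [← h1, ← Set.ncard_coe_finset]
    refine Set.ncard_le_ncard ?_ (Finset.finite_toSet _)
    rintro _ ⟨h, rfl⟩
    have h2 := hN.conj_mem g hgx h⁻¹
    rw [mem_stabilizer_iff, inv_inv, mul_smul, mul_smul, inv_smul_eq_iff] at h2
    simpa using h2
  have hswap : ∑ g : H, (Finset.univ.filter fun x : X => g • x = x).card =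
      ∑ x : X, (Finset.univ.filter fun g : H => g • x = x).card := by
    simp only [Finset.card_filter]
    exact Finset.sum_comm
  have h1 : Fintype.card H * p ≤ ∑ g : H, (Finset.univ.filter fun x : X => g • x = x).card := by
    rw [← smul_eq_mul, ← Finset.card_univ, ← Finset.sum_const]
    exact Finset.sum_le_sum fun g _ => hfix g
  have h2 : (∑ x : X, (Finset.univ.filter fun g : H => g • x = x).card) * p =
      3 * p * Fintype.card H := by
    rw [Finset.sum_mul, Finset.sum_congr rfl fun x _ => hstab x, Finset.sum_const,
      Finset.card_univ, hX, smul_eq_mul]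
  rw [hswap] at h1
  have h3 : 0 < Fintype.card H := Fintype.card_pos
  have h4 : Fintype.card H * p * p ≤ 3 * p * Fintype.card H := h2 ▸ Nat.mul_le_mul_right p h1
  have h5 : (Fintype.card H * p) * p ≤ (Fintype.card H * p) * 3 := by linarith
  have := Nat.le_of_mul_le_mul_left h5 (by positivity)
  omega

/-- In a transitive group of degree `3 * p`, `5 ≤ p`, the point stabilizers of a Sylow
`p`-subgroup have index `p`. -/
theorem Sylow.index_stabilizer_eq {G : Type*} [Group G] [Finite G] [MulAction G X] [Fintype X]
    [IsPretransitive G X] (hp5 : 5 ≤ p) (hX : Fintype.card X = 3 * p) (P : Sylow p G) (x : X) :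
    (stabilizer P x).index = p := by
  have hp : p.Prime := Fact.out
  obtain ⟨n, hn⟩ := P.2.card_orbit x
  rw [Nat.card_coe_set_eq, ← index_stabilizer] at hn
  have hle : p ^ n ≤ 3 * p := by
    rw [← hn, index_stabilizer, ← hX, ← Nat.card_eq_fintype_card, ← Set.ncard_univ]
    exact Set.ncard_le_ncard (Set.subset_univ _)
  have hn2 : n < 2 := by
    by_contra! h
    have : p ^ 2 ≤ p ^ n := Nat.pow_le_pow_right hp.pos h
    nlinarith
  have hn0 : n ≠ 0 := by
    rintro rfl
    rw [pow_zero, Subgroup.index_eq_one] at hn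
    -- If `P` fixed `x`, its index would be divisible by the orbit length $3p$, hence by `p`.
    have h1 : (P : Subgroup G) ≤ stabilizer G x := fun g hg => by
      have : (⟨g, hg⟩ : P) ∈ stabilizer P x := hn ▸ Subgroup.mem_top _
      exact this
    have h2 := Subgroup.index_dvd_of_le h1
    rw [index_stabilizer_of_transitive, Nat.card_eq_fintype_card, hX] at h2
    exact P.not_dvd_index ((Dvd.intro_left 3 rfl).trans h2)
  have : n = 1 := by omega
  rw [hn, this, pow_one]

end PGroup

/-- A group of pairs of a permutation of three letters and a unit modulo `p` has order dividing `8`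
if it involves no three-cycles and the units paired with the identity have order dividing `4`. -/
theorem card_dvd_eight {p : ℕ} [Fact p.Prime] (K : Subgroup (Equiv.Perm (Fin 3) × (ZMod p)ˣ))
    (h3 : ∀ k ∈ K, orderOf k.1 ≠ 3) (h4 : ∀ l, (1, l) ∈ K → orderOf l ∣ 4) : Nat.card K ∣ 8 := by
  let f : K →* Equiv.Perm (Fin 3) := (MonoidHom.fst _ _).comp K.subtype
  have h1 : Nat.card f.range ∣ 2 := by
    have h6 : Nat.card f.range ∣ 2 * 3 := by
      have := Subgroup.card_subgroup_dvd_card f.range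
      rwa [Nat.card_eq_fintype_card (α := Equiv.Perm (Fin 3)), Fintype.card_perm,
        Fintype.card_fin] at this
    -- By Cauchy, order divisible by $3$ would produce an excluded three-cycle.
    have hcop : Nat.Coprime (Nat.card f.range) 3 := by
      rw [Nat.coprime_comm, Nat.prime_three.coprime_iff_not_dvd]
      intro hdvd
      have : Fact (Nat.Prime 3) := ⟨Nat.prime_three⟩
      obtain ⟨⟨a, ha⟩, hk⟩ := exists_prime_orderOf_dvd_card' 3 hdvd
      rw [Subgroup.orderOf_mk] at hk
      obtain ⟨k, rfl⟩ := MonoidHom.mem_range.1 ha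
      exact h3 k.1 k.2 hk
    exact hcop.dvd_of_dvd_mul_right h6
  have h2 : Nat.card f.ker ∣ 4 := by
    let B : Subgroup (ZMod p)ˣ := K.comap (MonoidHom.inr (Equiv.Perm (Fin 3)) (ZMod p)ˣ)
    have hB : Nat.card B ∣ 4 := by
      obtain ⟨l, hl⟩ := IsCyclic.exists_ofOrder_eq_natCard (α := B)
      rw [← hl, ← Subgroup.orderOf_coe]
      exact h4 l l.2
    have e : f.ker ≃ B :=
      { toFun := fun k => ⟨k.1.1.2, by
          have h : k.1.1.1 = 1 := k.2
          change (1, k.1.1.2) ∈ K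
          rw [← h]
          exact k.1.2⟩
        invFun := fun l => ⟨⟨(1, l.1), l.2⟩, rfl⟩
        left_inv := fun k => by
          have h : k.1.1.1 = 1 := k.2
          apply Subtype.ext
          apply Subtype.ext
          exact Prod.ext h.symm rfl
        right_inv := fun l => rfl }
    rwa [Nat.card_congr e]
  rw [← f.ker.card_mul_index, Subgroup.index_ker]
  exact mul_dvd_mul h2 h1

/-! ### The Sylow subgroup and its normalizer as affine maps -/

section Main

variable {Ω : Type*} {p : ℕ} {G : Subgroup (Equiv.Perm Ω)}

/-- A Sylow `p`-subgroup is generated by a permutation without fixed points. -/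
theorem TypeIIGraph.exists_sylow_eq_zpowers [Fintype Ω] [Fact p.Prime] (Γ : TypeIIGraph p G)
    (hp5 : 5 ≤ p) (hΩ : Fintype.card Ω = 3 * p) [MulAction.IsPretransitive G Ω] (P : Sylow p G) :
    ∃ (z : G) (e : Fin 3 × ZMod p ≃ Ω), (P : Subgroup G) = Subgroup.zpowers z ∧
      ∀ i x, (z : Equiv.Perm Ω) (e (i, x)) = e (i, x + 1) := by
  have hp : p.Prime := Fact.out
  have hindex := fun x : Ω => Sylow.index_stabilizer_eq hp5 hΩ P x
  have hfaith : FaithfulSMul P Ω := ⟨fun {a b} h => by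
    apply Subtype.ext
    apply Subtype.ext
    exact Equiv.ext h⟩
  have hab := pow_eq_one_and_commute (X := Ω) P.2 hindex
  obtain ⟨z, hz⟩ := exists_smul_ne (X := Ω) hp5 hΩ P.2 hindex
  have hz' : ∀ x, (z.1 : Equiv.Perm Ω) x ≠ x := hz
  have hzp : (z.1 : Equiv.Perm Ω) ^ p = 1 := by
    have := congrArg (fun a : P => ((a.1 : G) : Equiv.Perm Ω)) (hab z 1).1
    simpa using this
  obtain ⟨e, he⟩ := exists_coordinates hp hΩ hzp hz'
  refine ⟨z.1, e, le_antisymm (fun h hh => ?_) (by rw [Subgroup.zpowers_le]; exact z.2), he⟩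
  have horbit : ∀ i, ∃ c, (h : Equiv.Perm Ω) (e (i, 0)) = e (i, c) := by
    intro i
    have h1 : Set.range (fun c => e (i, c)) ⊆ MulAction.orbit P (e (i, 0)) := by
      rintro _ ⟨c, rfl⟩
      obtain ⟨n, rfl⟩ := ZMod.natCast_zmod_surjective c
      refine ⟨z ^ n, ?_⟩
      have := pow_apply_coordinates he n i 0
      rw [zero_add] at this
      exact this
    -- A block is a cycle of `z` inside a `P`-orbit, and both have `p` points; so `P` preserves the
    -- blocks.
    have h2 : Set.range (fun c => e (i, c)) = MulAction.orbit P (e (i, 0)) := by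
      apply Set.eq_of_subset_of_ncard_le h1
      rw [← MulAction.index_stabilizer, hindex, ← Set.image_univ,
        Set.ncard_image_of_injective _ (fun x y h => by simpa using h), Set.ncard_univ,
        Nat.card_zmod]
    have h3 : (h : Equiv.Perm Ω) (e (i, 0)) ∈ MulAction.orbit P (e (i, 0)) := ⟨⟨h, hh⟩, rfl⟩
    rw [← h2] at h3
    obtain ⟨c, hc⟩ := h3
    exact ⟨c, hc.symm⟩
  choose b hb using horbit
  have hcomm : ∀ n : ℕ, ∀ w, (h : Equiv.Perm Ω) (((z.1 : Equiv.Perm Ω) ^ n) w) =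
      ((z.1 : Equiv.Perm Ω) ^ n) ((h : Equiv.Perm Ω) w) := fun n w => by
    have := congrArg (fun a : P => ((a.1 : G) : Equiv.Perm Ω) w) (hab ⟨h, hh⟩ (z ^ n)).2
    simpa using this
  have hb' : ∀ i x, (h : Equiv.Perm Ω) (e (i, x)) = e (i, x + b i) := by
    intro i x
    obtain ⟨n, rfl⟩ := ZMod.natCast_zmod_surjective x
    have h1 := pow_apply_coordinates he n i 0
    rw [zero_add] at h1
    rw [← h1, hcomm, hb, pow_apply_coordinates he, add_comm]
  have hconst := Γ.translation_const hp hp5 z.1.2 he h.2 hb'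
  obtain ⟨n, hn⟩ := ZMod.natCast_zmod_surjective (b 0)
  refine ⟨n, ?_⟩
  apply Subtype.ext
  apply Equiv.ext
  intro w
  obtain ⟨⟨i, x⟩, rfl⟩ := e.surjective w
  rw [hb', hconst i 0, ← hn, ← pow_apply_coordinates he]
  simp

/-- A permutation normalizing the group generated by a translation acts affinely. -/
theorem exists_affine [Finite Ω] [Fact p.Prime] {z g : Equiv.Perm Ω} {e : Fin 3 × ZMod p ≃ Ω}
    (he : ∀ i x, z (e (i, x)) = e (i, x + 1)) (hg : g * z * g⁻¹ ∈ Subgroup.zpowers z) :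
    ∃ (σ : Equiv.Perm (Fin 3)) (l : (ZMod p)ˣ) (b : Fin 3 → ZMod p),
      ∀ i x, g (e (i, x)) = e (σ i, l * x + b i) := by
  obtain ⟨m, hm : z ^ m = g * z * g⁻¹⟩ := mem_powers_iff_mem_zpowers.2 hg
  let s : Fin 3 → Fin 3 := fun i => (e.symm (g (e (i, 0)))).1
  let b : Fin 3 → ZMod p := fun i => (e.symm (g (e (i, 0)))).2
  have hsb : ∀ i, g (e (i, 0)) = e (s i, b i) := fun i => by simp [s, b]
  -- From $gzg^{-1}=z^m$: the exponent `m` becomes the multiplier, common to all blocks.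
  have hgz : ∀ n : ℕ, ∀ w, g ((z ^ n) w) = (z ^ (m * n)) (g w) := fun n w => by
    rw [pow_mul, hm, conj_pow]
    simp
  have haff : ∀ i x, g (e (i, x)) = e (s i, m * x + b i) := fun i x => by
    obtain ⟨n, rfl⟩ := ZMod.natCast_zmod_surjective x
    have h1 := pow_apply_coordinates he n i 0
    rw [zero_add] at h1
    rw [← h1, hgz, hsb, pow_apply_coordinates he, add_comm]
    push_cast
    rfl
  have hsurj : Function.Surjective s := fun j => by
    obtain ⟨w, hw⟩ := g.surjective (e (j, 0))
    obtain ⟨⟨i, x⟩, rfl⟩ := e.surjective w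
    rw [haff, e.apply_eq_iff_eq] at hw
    exact ⟨i, congrArg Prod.fst hw⟩
  have hm0 : (m : ZMod p) ≠ 0 := fun h0 => by
    have h1 : g (e (0, 0)) = g (e (0, 1)) := by rw [haff, haff, h0]; simp
    simp at h1
  exact ⟨Equiv.ofBijective s (Finite.injective_iff_bijective.1
    (Finite.injective_iff_surjective.2 hsurj)), Units.mk0 m hm0, b, haff⟩

theorem affine_unique [NeZero p] {e : Fin 3 × ZMod p ≃ Ω} {σ σ' : Equiv.Perm (Fin 3)}
    {l l' : (ZMod p)ˣ} {b b' : Fin 3 → ZMod p}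
    (h : ∀ i x, e (σ i, l * x + b i) = e (σ' i, l' * x + b' i)) : σ = σ' ∧ l = l' ∧ b = b' := by
  have h' : ∀ i x, σ i = σ' i ∧ l * x + b i = l' * x + b' i := fun i x => by simpa using h i x
  have hb : b = b' := funext fun i => by simpa using (h' i 0).2
  refine ⟨Equiv.ext fun i => (h' i 0).1, Units.ext ?_, hb⟩
  simpa [hb] using (h' 0 1).2

/-- The index of a Sylow `p`-subgroup in its normalizer divides `8`, whatever the signs of the
permutations in the group. -/
theorem TypeIIGraph.relIndex_normalizer_dvd_eight [Fintype Ω] [Fact p.Prime] (Γ : TypeIIGraph p G)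
    (hp5 : 5 ≤ p) (hΩ : Fintype.card Ω = 3 * p) [MulAction.IsPretransitive G Ω] (P : Sylow p G) :
    (P : Subgroup G).relIndex (Subgroup.normalizer (P : Set G)) ∣ 8 := by
  have hp : p.Prime := Fact.out
  obtain ⟨z, e, hP, he⟩ := Γ.exists_sylow_eq_zpowers hp5 hΩ P
  have haff : ∀ g : Subgroup.normalizer (P : Set G), ∃ (σ : Equiv.Perm (Fin 3)) (l : (ZMod p)ˣ)
      (b : Fin 3 → ZMod p), ∀ i x, (g.1 : Equiv.Perm Ω) (e (i, x)) = e (σ i, l * x + b i) := by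
    intro g
    apply exists_affine he
    have h1 : g.1 * z * g.1⁻¹ ∈ (P : Subgroup G) :=
      (Subgroup.mem_normalizer_iff.1 g.2 z).1 (by
        rw [hP]; exact Subgroup.mem_zpowers z)
    rw [hP] at h1
    obtain ⟨n, hn⟩ := h1
    exact ⟨n, by simpa using congrArg Subtype.val hn⟩
  choose σ l b h using haff
  let φ : Subgroup.normalizer (P : Set G) →* Equiv.Perm (Fin 3) × (ZMod p)ˣ :=
    MonoidHom.mk' (fun g => (σ g, l g)) fun g g' => by
      obtain ⟨h1, h2, -⟩ := affine_unique (e := e) (σ := σ (g * g')) (l := l (g * g'))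
        (b := b (g * g')) (σ' := σ g * σ g') (l' := l g * l g')
        (b' := fun i => l g * b g' i + b g (σ g' i)) fun i x => by
          rw [← h]
          change (g.1 : Equiv.Perm Ω) ((g'.1 : Equiv.Perm Ω) (e (i, x))) = _
          rw [h, h]
          congr 2
          push_cast
          ring
      exact Prod.ext h1 h2
  -- Kernel elements translate each block; `translation_const` makes the three amounts equal, so
  -- they are powers of `z`.
  have hker : φ.ker = (P : Subgroup G).subgroupOf (Subgroup.normalizer (P : Set G)) := by
    ext g
    rw [MonoidHom.mem_ker, Subgroup.mem_subgroupOf, hP]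
    constructor
    · intro hg
      have hσ : σ g = 1 := congrArg Prod.fst hg
      have hl : l g = 1 := congrArg Prod.snd hg
      have hg' : ∀ i x, (g.1 : Equiv.Perm Ω) (e (i, x)) = e (i, x + b g i) := fun i x => by
        rw [h, hσ, hl]; simp
      have hconst := Γ.translation_const hp hp5 z.2 he g.1.2 hg'
      obtain ⟨n, hn⟩ := ZMod.natCast_zmod_surjective (b g 0)
      refine ⟨n, ?_⟩
      apply Subtype.ext
      apply Equiv.ext
      intro w
      obtain ⟨⟨i, x⟩, rfl⟩ := e.surjective w
      rw [hg', hconst i 0, ← hn, ← pow_apply_coordinates he]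
      simp
    · intro hg
      obtain ⟨n, hn : z ^ n = g.1⟩ := mem_powers_iff_mem_zpowers.2 hg
      obtain ⟨h1, h2, -⟩ := affine_unique (e := e) (σ := σ g) (l := l g) (b := b g) (σ' := 1)
        (l' := 1) (b' := fun _ => n) fun i x => by
          rw [← h, ← hn]
          simpa using pow_apply_coordinates he n i x
      exact Prod.ext h1 h2
  rw [Subgroup.relIndex, ← hker, Subgroup.index_ker]
  apply card_dvd_eight
  · rintro _ ⟨g, rfl⟩
    exact Γ.not_three_cycle hp hp5 z.2 he g.1.2 (h g)
  · rintro l' ⟨g, hg⟩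
    have hσ : σ g = 1 := congrArg Prod.fst hg
    have hl : l g = l' := congrArg Prod.snd hg
    refine Γ.orderOf_dvd_four hp hp5 z.2 he g.1.2 (b := b g) fun i x => ?_
    rw [h, hσ, hl]
    rfl

end Main

end PrimitiveDegree3p

theorem mainTheorem12 {Ω : Type*} [Fintype Ω] [DecidableEq Ω] (p : ℕ) (hp : p.Prime)
    (hp5 : 5 ≤ p) (hΩ : Fintype.card Ω = 3 * p) (G : Subgroup (Equiv.Perm Ω))
    (hprim : MulAction.IsPreprimitive G Ω) (hII : PrimitiveDegree3p.IsTypeII p G)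
    (P : Sylow p G) :
    ((∀ g ∈ G, Equiv.Perm.sign g = 1) →
      (P : Subgroup G).relIndex (Subgroup.normalizer (P : Set G)) ∣ 8) ∧
    ((∃ g ∈ G, Equiv.Perm.sign g = -1) →
      (P : Subgroup G).relIndex (Subgroup.normalizer (P : Set G)) ∣ 16) := by
  have : Fact p.Prime := ⟨hp⟩
  have htrans : MulAction.IsPretransitive G Ω := hprim.toIsPretransitive
  obtain ⟨Γ⟩ := hII.nonempty_graph hp5 hΩ fun x y => by
    obtain ⟨g, hg⟩ := MulAction.exists_smul_eq G x y
    exact ⟨g, g.2, hg⟩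
  have h8 := Γ.relIndex_normalizer_dvd_eight hp5 hΩ P
  exact ⟨fun _ => h8, fun _ => h8.trans (by norm_num)⟩
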